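/- **Setting.** Let $\dot{\mathfrak g}$ be a finite-dimensional simple Lie algebra over $\mathbb C$ with Cartan subalgebra $\dot{\mathfrak h}$, a choice of positive roots, $\dot{\mathfrak g}_+$ the sum of the positive root spaces, and a non-degenerate invariant symmetric bilinear form $(\cdot|\cdot)$. Let $\nu\ge 1$, $A=\mathbb C[t_0^{\pm1},\dots,t_\nu^{\pm1}]$, $d_p=t_p\frac{\partial}{\partial t_p}$, and write $t^{\mathbf m}=t_0^{m_0}\cdots t_\nu^{m_\nu}$ for $\mathbf m\in\mathbb Z^{\nu+1}$. Let $\mathcal D=\operatorname{Der}A$ and let $\mathcal K$ be the vector space spanned by symbols $t^{\mathbf r}k_p$ ($\mathbf r\in\mathbb Z^{\nu+1}$, $0\le p\le \nu$) subject to $\sum_{p}r_p\,t^{\mathbf r}k_p=0$. Fix $c_1,c_2\in\mathbb C$. The full toroidal Lie algebra $\tau=\dot{\mathfrak g}\otimes A\oplus\mathcal K\oplus\mathcal D$ has the bracket $$[x\otimes t^{\mathbf m},y\otimes t^{\mathbf n}]=[x,y]\otimes t^{\mathbf m+\mathbf n}+(x|y)\sum_p m_p t^{\mathbf m+\mathbf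 n}k_p,\qquad [\dot{\mathfrak g}\otimes A\oplus\mathcal K,\ \mathcal K]=0,$$ $$[t^{\mathbf m}d_a,x\otimes t^{\mathbf n}]=n_a\,x\otimes t^{\mathbf m+\mathbf n},\qquad [t^{\mathbf m}d_a,t^{\mathbf n}k_b]=n_at^{\mathbf m+\mathbf n}k_b+\delta_{ab}\sum_p m_pt^{\mathbf m+\mathbf n}k_p,$$ $$[t^{\mathbf m}d_a,t^{\mathbf n}d_b]=n_at^{\mathbf m+\mathbf n}d_b-m_bt^{\mathbf m+\mathbf n}d_a+(c_2m_an_b-c_1n_am_b)\sum_pm_pt^{\mathbf m+\mathbf n}k_p .$$ Let $B$ be a finitely generated commutative associative unital $\mathbb C$-algebra and $\tau(B)=\tau\otimes B$ with $[x\otimes b,y\otimes b']=[x,y]\otimes bb'$. Let $\mathfrak h=\dot{\mathfrak h}\oplus\bigoplus_{i=0}^\nu\mathbb Ck_i\oplus\bigoplus_{i=0}^\nu\mathbb Cd_i\subset\tau$, acting on $\tau(B)$-modules through $\mathfrak h\otimes 1$. A $\tau(B)$-module $V$ is *integrable* if it is the direct sum of its weight spaces $V_\lambda$, $\lambda\in\mathfrak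 h^*$, and every $x\otimes t^{\mathbf m}\otimes b$ with $x$ in a root space $\dot{\mathfrak g}_\alpha$, $\alpha\neq0$, $\mathbf m\in\mathbb Z^{\nu+1}$, $b\in B$, acts locally nilpotently on $V$. **Theorem 5.5.** Let $V$ be an irreducible integrable $\tau(B)$-module with finite-dimensional weight spaces on which all $k_p\otimes 1$ ($0\le p\le\nu$) act by zero. Let $$T=\{v\in V:(\dot{\mathfrak g}_+\otimes A\otimes B)\,v=0\}$$ and let $\Lambda\in\mathfrak h^*$ be a weight of $T$ (that is, $T\cap V_\Lambda\neq0$) with $\Lambda|_{\dot{\mathfrak h}}\neq0$. Then $(t^{\mathbf m}k_p\otimes b)\,v=0$ for all $\mathbf m\in\mathbb Z^{\nu+1}$, $0\le p\le\nu$, $b\in B$ and $v\in T$. -/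

import Mathlib

open scoped TensorProduct

noncomputable section

namespace MapToroidal

/-! ### Laurent polynomials and their derivations -/

/-- The Laurent polynomial algebra `A = ℂ[t₀^{±1}, …, t_ν^{±1}]` in `ν + 1` variables. -/
def Laurent (ν : ℕ) : Type := AddMonoidAlgebra ℂ (Fin (ν + 1) → ℤ)

instance (ν : ℕ) : CommRing (Laurent ν) :=
  inferInstanceAs (CommRing (AddMonoidAlgebra ℂ (Fin (ν + 1) → ℤ)))

instance (ν : ℕ) : Algebra ℂ (Laurent ν) :=
  inferInstanceAs (Algebra ℂ (AddMonoidAlgebra ℂ (Fin (ν + 1) → ℤ)))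

/-- The monomial `t^m = t₀^{m₀} ⋯ t_ν^{m_ν}`. -/
def mono {ν : ℕ} (m : Fin (ν + 1) → ℤ) : Laurent ν :=
  (AddMonoidAlgebra.single m 1 : AddMonoidAlgebra ℂ (Fin (ν + 1) → ℤ))

/-- The basis of `A` consisting of the monomials. -/
def monoBasis (ν : ℕ) : Module.Basis (Fin (ν + 1) → ℤ) ℂ (Laurent ν) :=
  AddMonoidAlgebra.basis (Fin (ν + 1) → ℤ) ℂ

lemma monoBasis_apply {ν : ℕ} (m : Fin (ν + 1) → ℤ) : monoBasis ν m = mono m :=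
  AddMonoidAlgebra.basis_apply ℂ m

lemma mono_mul {ν : ℕ} (m n : Fin (ν + 1) → ℤ) : mono m * mono n = mono (m + n) := by
  have h : (AddMonoidAlgebra.single m (1 : ℂ) * AddMonoidAlgebra.single n (1 : ℂ)) =
      AddMonoidAlgebra.single (m + n) (1 : ℂ) := by
    rw [AddMonoidAlgebra.single_mul_single, one_mul]
  exact h

lemma mono_zero {ν : ℕ} : (mono 0 : Laurent ν) = 1 := rfl

lemma laurent_hom_ext {ν : ℕ} {M : Type*} [AddCommGroup M] [Module ℂ M]
    {f g : Laurent ν →ₗ[ℂ] M} (h : ∀ m, f (mono m) = g (mono m)) : f = g :=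
  (monoBasis ν).ext (fun m => by simpa [monoBasis_apply] using h m)

/-- The degree operator `t_p ∂/∂t_p` as a linear map, `t^m ↦ m_p t^m`. -/
def degLin {ν : ℕ} (p : Fin (ν + 1)) : Laurent ν →ₗ[ℂ] Laurent ν :=
  (monoBasis ν).constr ℂ (fun m => (m p : ℂ) • mono m)

lemma degLin_mono {ν : ℕ} (p : Fin (ν + 1)) (m : Fin (ν + 1) → ℤ) :
    degLin p (mono m) = (m p : ℂ) • mono m := by
  rw [← monoBasis_apply, degLin, Module.Basis.constr_basis, monoBasis_apply]

/-- The degree derivation `d_p = t_p ∂/∂t_p` of `A`. -/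
def deg {ν : ℕ} (p : Fin (ν + 1)) : Derivation ℂ (Laurent ν) (Laurent ν) :=
  Derivation.mk' (degLin p) (by
    intro f g
    have key : (LinearMap.mul ℂ (Laurent ν)).compr₂ (degLin p) =
        (LinearMap.mul ℂ (Laurent ν)).compl₂ (degLin p) +
          ((LinearMap.mul ℂ (Laurent ν)).flip.compl₂ (degLin p)).flip := by
      refine laurent_hom_ext fun m => laurent_hom_ext fun n => ?_
      simp only [LinearMap.compr₂_apply, LinearMap.mul_apply', LinearMap.add_apply,
        LinearMap.compl₂_apply, LinearMap.flip_apply, degLin_mono, mono_mul]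
      simp only [mul_smul_comm, smul_mul_assoc, mono_mul, Pi.add_apply, Int.cast_add, add_smul]
      abel
    have := LinearMap.congr_fun (LinearMap.congr_fun key f) g
    simpa [mul_comm] using this)

lemma deg_mono {ν : ℕ} (p : Fin (ν + 1)) (m : Fin (ν + 1) → ℤ) :
    deg p (mono m) = (m p : ℂ) • mono m := degLin_mono p m

lemma deg_comm {ν : ℕ} (a b : Fin (ν + 1)) (f : Laurent ν) : deg a (deg b f) = deg b (deg a f) := by
  have : (deg a : Laurent ν →ₗ[ℂ] Laurent ν) ∘ₗ (deg b : Laurent ν →ₗ[ℂ] Laurent ν) =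
      (deg b : Laurent ν →ₗ[ℂ] Laurent ν) ∘ₗ (deg a : Laurent ν →ₗ[ℂ] Laurent ν) := by
    refine laurent_hom_ext fun m => ?_
    simp [deg_mono, smul_smul, mul_comm]
  exact LinearMap.congr_fun this f

/-- The Lie algebra `𝒟` of derivations of `A`. -/
abbrev Der (ν : ℕ) : Type := Derivation ℂ (Laurent ν) (Laurent ν)

/-- The coefficient `u_a ∈ A` of a derivation `u = ∑ u_a d_a`, namely `t_a⁻¹ u(t_a)`. -/
def coef {ν : ℕ} (u : Der ν) (a : Fin (ν + 1)) : Laurent ν :=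
  mono (-Pi.single a 1) * u (mono (Pi.single a 1))

lemma coef_add {ν : ℕ} (u v : Der ν) (a : Fin (ν + 1)) : coef (u + v) a = coef u a + coef v a := by
  simp [coef, mul_add]

lemma coef_smul {ν : ℕ} (c : ℂ) (u : Der ν) (a : Fin (ν + 1)) : coef (c • u) a = c • coef u a := by
  simp [coef]

lemma coef_smul_deg {ν : ℕ} (f : Laurent ν) (a b : Fin (ν + 1)) :
    coef (f • deg a) b = if a = b then f else 0 := by
  have h : mono (-Pi.single b 1) * (mono (Pi.single b 1) : Laurent ν) = 1 := by
    rw [mono_mul, neg_add_cancel, mono_zero]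
  simp only [coef, Derivation.smul_apply, deg_mono, smul_eq_mul, mul_smul_comm]
  rw [mul_left_comm, h]
  by_cases hab : a = b
  · subst hab; simp
  · simp [hab]

lemma der_sum_apply {ν : ℕ} {ι : Type*} (s : Finset ι) (u : ι → Der ν) (f : Laurent ν) :
    (∑ i ∈ s, u i) f = ∑ i ∈ s, u i f := by
  classical
  induction s using Finset.induction_on with
  | empty => simp
  | insert i s hi ih => rw [Finset.sum_insert hi, Finset.sum_insert hi, Derivation.add_apply, ih]

/-- Every derivation of `A` is `∑ₐ uₐ dₐ`. -/
lemma der_eq_sum {ν : ℕ} (u : Der ν) : u = ∑ a, coef u a • deg a := by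
  set v : Der ν := u - ∑ a, coef u a • deg a with hv
  have h1 : ∀ b, v (mono (Pi.single b 1)) = 0 := by
    intro b
    have h : mono (Pi.single b 1) * (mono (-Pi.single b 1) : Laurent ν) = 1 := by
      rw [mono_mul, add_neg_cancel, mono_zero]
    have hsum : (∑ a, coef u a • deg a : Der ν) (mono (Pi.single b 1)) =
        u (mono (Pi.single b 1)) := by
      rw [der_sum_apply, Finset.sum_eq_single b]
      · simp only [Derivation.smul_apply, deg_mono, Pi.single_eq_same, Int.cast_one, one_smul,
          smul_eq_mul, coef]
        rw [mul_right_comm, mul_comm (mono (-Pi.single b 1)), h, one_mul]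
      · intro a _ hab
        simp [deg_mono, hab]
      · simp
    rw [hv, Derivation.sub_apply, hsum, sub_self]
  have hadd : ∀ m n, v (mono m) = 0 → v (mono n) = 0 → v (mono (m + n)) = 0 := by
    intro m n hm hn
    rw [← mono_mul, Derivation.leibniz, hm, hn]; simp
  have hneg : ∀ m, v (mono m) = 0 → v (mono (-m)) = 0 := by
    intro m hm
    have h : mono (-m) * (mono m : Laurent ν) = 1 := by
      rw [mono_mul, neg_add_cancel, mono_zero]
    have h2 : v (mono (-m) * mono m) = 0 := by rw [h]; simp
    rw [Derivation.leibniz, hm, smul_zero, zero_add, smul_eq_mul] at h2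
    calc v (mono (-m)) = (mono (-m) * mono m) * v (mono (-m)) := by rw [h, one_mul]
      _ = mono (-m) * (mono m * v (mono (-m))) := by ring
      _ = 0 := by rw [h2, mul_zero]
  have hall : ∀ m, v (mono m) = 0 := by
    intro m
    let S : AddSubgroup (Fin (ν + 1) → ℤ) :=
      { carrier := {m | v (mono m) = 0}
        zero_mem' := by simp [mono_zero]
        add_mem' := fun {a b} ha hb => hadd a b ha hb
        neg_mem' := fun {a} ha => hneg a ha }
    have hm : m = ∑ a, m a • (Pi.single a 1 : Fin (ν + 1) → ℤ) := by
      ext b; simp [Finset.sum_apply, Pi.single_apply]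
    have : m ∈ S := by
      rw [hm]
      exact S.sum_mem fun a _ => S.zsmul_mem (h1 a) _
    exact this
  have hv0 : v = 0 := by
    have : (v : Laurent ν →ₗ[ℂ] Laurent ν) = 0 := laurent_hom_ext fun m => by simpa using hall m
    ext1 f
    exact LinearMap.congr_fun this f
  exact sub_eq_zero.mp hv0

lemma der_apply {ν : ℕ} (u : Der ν) (f : Laurent ν) : u f = ∑ a, coef u a * deg a f := by
  conv_lhs => rw [der_eq_sum u]
  simp [der_sum_apply]

lemma coef_lie {ν : ℕ} (u v : Der ν) (a : Fin (ν + 1)) :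
    coef ⁅u, v⁆ a = u (coef v a) - v (coef u a) := by
  set t : Laurent ν := mono (Pi.single a 1)
  set s : Laurent ν := mono (-Pi.single a 1)
  have hst : s * t = 1 := by
    simp only [s, t]; rw [mono_mul, neg_add_cancel, mono_zero]
  have hd : ∀ w : Der ν, w s = - (s * s * w t) := by
    intro w
    have h := congrArg w hst
    rw [Derivation.leibniz, Derivation.map_one_eq_zero, smul_eq_mul, smul_eq_mul] at h
    have h2 : w s = (s * t) * w s := by rw [hst, one_mul]
    rw [h2]
    linear_combination s * h
  simp only [coef, Derivation.commutator_apply, Derivation.leibniz, smul_eq_mul]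
  change s * (u (v t) - v (u t)) = s * u (v t) + v t * u s - (s * v (u t) + u t * v s)
  rw [hd u, hd v]; ring

/-- `d_b (u f) = u (d_b f) + ∑_c d_b(u_c) d_c f`. -/
lemma deg_der {ν : ℕ} (u : Der ν) (b : Fin (ν + 1)) (f : Laurent ν) :
    deg b (u f) = u (deg b f) + ∑ c, deg b (coef u c) * deg c f := by
  rw [der_apply u f, der_apply u (deg b f), map_sum, ← Finset.sum_add_distrib]
  refine Finset.sum_congr rfl fun c _ => ?_
  rw [Derivation.leibniz, deg_comm b c]
  simp only [smul_eq_mul]; ring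

/-- The divergence `∑ₐ dₐ(uₐ)` of `u = ∑ uₐ dₐ`. -/
def dvg {ν : ℕ} (u : Der ν) : Laurent ν := ∑ a, deg a (coef u a)

/-- The matrix `(d_b(u_a))_{b,a}` of `u = ∑ uₐ dₐ`. -/
def jac {ν : ℕ} (u : Der ν) : Matrix (Fin (ν + 1)) (Fin (ν + 1)) (Laurent ν) :=
  fun b a => deg b (coef u a)

lemma jac_lie {ν : ℕ} (u v : Der ν) :
    jac ⁅u, v⁆ = (jac v).map u - (jac u).map v + (jac u * jac v - jac v * jac u) := by
  ext1 b a
  simp only [jac, coef_lie, map_sub, deg_der, Matrix.add_apply, Matrix.sub_apply, Matrix.map_apply,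
    Matrix.mul_apply]
  abel

lemma dvg_lie {ν : ℕ} (u v : Der ν) : dvg ⁅u, v⁆ = u (dvg v) - v (dvg u) := by
  simp only [dvg, coef_lie, map_sub, deg_der, Finset.sum_add_distrib, Finset.sum_sub_distrib,
    map_sum]
  have : ∑ x, ∑ c, deg x (coef u c) * deg c (coef v x) =
      ∑ x, ∑ c, deg x (coef v c) * deg c (coef u x) := by
    rw [Finset.sum_comm]
    simp_rw [mul_comm]
  rw [this]; abel

/-! ### The space `𝒦` -/

/-- The relations `∑_p r_p t^r k_p = 0`; here `(f_p)_p` stands for `∑_p f_p k_p`. -/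
def relK (ν : ℕ) : Submodule ℂ (Fin (ν + 1) → Laurent ν) :=
  Submodule.span ℂ (Set.range fun r : Fin (ν + 1) → ℤ => fun p => (r p : ℂ) • mono r)

/-- The space `𝒦`, spanned by the symbols `t^r k_p` subject to `∑_p r_p t^r k_p = 0`. -/
abbrev Ker (ν : ℕ) : Type := (Fin (ν + 1) → Laurent ν) ⧸ relK ν

/-- The element `f k_p` of `𝒦`. -/
def kEl {ν : ℕ} (p : Fin (ν + 1)) : Laurent ν →ₗ[ℂ] Ker ν :=
  (relK ν).mkQ ∘ₗ LinearMap.single ℂ (fun _ => Laurent ν) p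

lemma mkQ_eq_sum {ν : ℕ} (w : Fin (ν + 1) → Laurent ν) :
    (relK ν).mkQ w = ∑ p, kEl p (w p) := by
  simp only [kEl, LinearMap.comp_apply, ← map_sum]
  congr 1
  exact (Finset.univ_sum_single w).symm

/-- `f ↦ (d_p f)_p`. -/
def dAll {ν : ℕ} : Laurent ν →ₗ[ℂ] (Fin (ν + 1) → Laurent ν) :=
  LinearMap.pi fun p => (deg p : Laurent ν →ₗ[ℂ] Laurent ν)

lemma dAll_mem {ν : ℕ} (f : Laurent ν) : dAll f ∈ relK ν := by
  have : (relK ν).mkQ ∘ₗ dAll = 0 := by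
    refine laurent_hom_ext fun m => ?_
    rw [LinearMap.comp_apply, LinearMap.zero_apply, Submodule.mkQ_apply,
      Submodule.Quotient.mk_eq_zero]
    refine Submodule.subset_span ⟨m, ?_⟩
    ext1 p
    simp [dAll, deg_mono]
  rw [← Submodule.Quotient.mk_eq_zero]
  exact LinearMap.congr_fun this f

/-- The pairing `⟪f, g⟫ = ∑_p d_p(f) g k_p ∈ 𝒦`. -/
def pair {ν : ℕ} : Laurent ν →ₗ[ℂ] Laurent ν →ₗ[ℂ] Ker ν :=
  ∑ p, (((LinearMap.mul ℂ (Laurent ν)) ∘ₗ (deg p : Laurent ν →ₗ[ℂ] Laurent ν)).compr₂ (kEl p))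

lemma pair_apply {ν : ℕ} (f g : Laurent ν) : pair f g = ∑ p, kEl p (deg p f * g) := by
  simp [pair, LinearMap.sum_apply]

lemma pair_eq_mkQ {ν : ℕ} (f g : Laurent ν) :
    pair f g = (relK ν).mkQ (fun p => deg p f * g) := by
  rw [pair_apply, mkQ_eq_sum]

lemma pair_skew {ν : ℕ} (f g : Laurent ν) : pair f g = - pair g f := by
  rw [eq_neg_iff_add_eq_zero, pair_eq_mkQ, pair_eq_mkQ, ← map_add, Submodule.mkQ_apply,
    Submodule.Quotient.mk_eq_zero]
  convert dAll_mem (f * g) using 1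
  ext1 p
  simp only [dAll, LinearMap.pi_apply, Derivation.coeFn_coe, Derivation.leibniz, smul_eq_mul,
    Pi.add_apply]
  ring

lemma pair_mul {ν : ℕ} (f g h : Laurent ν) : pair (f * g) h = pair f (g * h) + pair g (f * h) := by
  simp only [pair_eq_mkQ, ← map_add]
  congr 1
  ext1 p
  simp only [Derivation.leibniz, smul_eq_mul, Pi.add_apply]
  ring

lemma kEl_eq_pair {ν : ℕ} (p : Fin (ν + 1)) (g : Laurent ν) :
    kEl p g = pair (mono (Pi.single p 1)) (mono (-Pi.single p 1) * g) := by
  rw [pair_apply, Finset.sum_eq_single p]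
  · rw [deg_mono, Pi.single_eq_same, Int.cast_one, one_smul, ← mul_assoc, mono_mul, add_neg_cancel,
      mono_zero, one_mul]
  · intro q _ hq
    simp [deg_mono, hq]
  · simp

lemma ker_hom_ext {ν : ℕ} {M : Type*} [AddCommGroup M] [Module ℂ M] {F G : Ker ν →ₗ[ℂ] M}
    (h : ∀ f g, F (pair f g) = G (pair f g)) : F = G := by
  refine LinearMap.ext fun w => ?_
  obtain ⟨w, rfl⟩ := (relK ν).mkQ_surjective w
  rw [mkQ_eq_sum, map_sum, map_sum]
  refine Finset.sum_congr rfl fun p _ => ?_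
  rw [kEl_eq_pair, h]

/-- The operator `(g_b)_b ↦ (u(g_b) + ∑ₐ gₐ d_b(uₐ))_b`, which induces the action of `u` on `𝒦`. -/
def lieForm {ν : ℕ} (u : Der ν) : (Fin (ν + 1) → Laurent ν) →ₗ[ℂ] (Fin (ν + 1) → Laurent ν) where
  toFun w := fun b => u (w b) + ∑ a, w a * deg b (coef u a)
  map_add' w w' := by
    ext1 b
    simp only [Pi.add_apply, map_add, add_mul, Finset.sum_add_distrib]
    abel
  map_smul' c w := by
    ext1 b
    simp [Finset.smul_sum, smul_add]

lemma lieForm_apply {ν : ℕ} (u : Der ν) (w : Fin (ν + 1) → Laurent ν) (b : Fin (ν + 1)) :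
    lieForm u w b = u (w b) + ∑ a, w a * deg b (coef u a) := rfl

lemma lieForm_mul_d {ν : ℕ} (u : Der ν) (f g : Laurent ν) :
    lieForm u (fun p => deg p f * g) =
      (fun p => deg p (u f) * g) + (fun p => deg p f * u g) := by
  ext1 b
  simp only [lieForm_apply, Pi.add_apply, deg_der, Derivation.leibniz, smul_eq_mul, add_mul,
    Finset.sum_mul]
  have : ∑ x, deg x f * g * deg b (coef u x) = ∑ x, deg b (coef u x) * deg x f * g :=
    Finset.sum_congr rfl fun x _ => by ring
  rw [this]; ring

/-- The action of a derivation `u` on `𝒦`: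
`(f dₐ) · (g k_b) = f dₐ(g) k_b + δ_{ab} ∑_p d_p(f) g k_p`. -/
def actK {ν : ℕ} (u : Der ν) : Ker ν →ₗ[ℂ] Ker ν :=
  (relK ν).mapQ (relK ν) (lieForm u) (by
    rw [relK, Submodule.span_le]
    rintro _ ⟨r, rfl⟩
    have h : lieForm u (fun p => (r p : ℂ) • mono r) = dAll (u (mono r)) := by
      have := lieForm_mul_d u (mono r) 1
      simp only [mul_one, Derivation.map_one_eq_zero, mul_zero, deg_mono] at this
      rw [this]
      ext1 p
      simp [dAll]
    change lieForm u (fun p => (r p : ℂ) • mono r) ∈ relK ν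
    rw [h]
    exact dAll_mem _)

lemma actK_pair {ν : ℕ} (u : Der ν) (f g : Laurent ν) :
    actK u (pair f g) = pair (u f) g + pair f (u g) := by
  rw [pair_eq_mkQ, pair_eq_mkQ, pair_eq_mkQ, ← map_add, ← lieForm_mul_d]
  rfl

lemma actK_add {ν : ℕ} (u v : Der ν) (w : Ker ν) : actK (u + v) w = actK u w + actK v w := by
  have : actK (u + v) = actK u + actK v := ker_hom_ext fun f g => by
    simp only [actK_pair, LinearMap.add_apply, Derivation.add_apply, map_add]
    abel
  rw [this, LinearMap.add_apply]

lemma actK_smul {ν : ℕ} (c : ℂ) (u : Der ν) (w : Ker ν) : actK (c • u) w = c • actK u w := by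
  have : actK (c • u) = c • actK u := ker_hom_ext fun f g => by
    simp only [actK_pair, LinearMap.smul_apply, Derivation.smul_apply, map_smul, smul_add]
  rw [this, LinearMap.smul_apply]

lemma actK_lie {ν : ℕ} (u v : Der ν) (w : Ker ν) :
    actK ⁅u, v⁆ w = actK u (actK v w) - actK v (actK u w) := by
  have : actK ⁅u, v⁆ = actK u ∘ₗ actK v - actK v ∘ₗ actK u := ker_hom_ext fun f g => by
    simp only [actK_pair, LinearMap.sub_apply, LinearMap.comp_apply, Derivation.commutator_apply,
      map_add, map_sub, LinearMap.sub_apply]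
    abel
  rw [this]; rfl

/-! ### The cocycles on `𝒟` with values in `𝒦` -/

/-- `∑_{a,b} ⟪X_{ba}, Y_{ab}⟫`. -/
def mpair {ν : ℕ} (X Y : Matrix (Fin (ν + 1)) (Fin (ν + 1)) (Laurent ν)) : Ker ν :=
  ∑ b, ∑ a, pair (X b a) (Y a b)

section mpair

variable {ν : ℕ} (X X' Y Y' Z : Matrix (Fin (ν + 1)) (Fin (ν + 1)) (Laurent ν))

lemma mpair_add_left : mpair (X + X') Y = mpair X Y + mpair X' Y := by
  simp [mpair, Finset.sum_add_distrib]

lemma mpair_add_right : mpair X (Y + Y') = mpair X Y + mpair X Y' := by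
  simp [mpair, Finset.sum_add_distrib]

lemma mpair_sub_left : mpair (X - X') Y = mpair X Y - mpair X' Y := by
  simp [mpair, Finset.sum_sub_distrib]

lemma mpair_sub_right : mpair X (Y - Y') = mpair X Y - mpair X Y' := by
  simp [mpair, Finset.sum_sub_distrib]

lemma mpair_skew : mpair X Y = - mpair Y X := by
  rw [mpair, mpair, Finset.sum_comm, ← Finset.sum_neg_distrib]
  refine Finset.sum_congr rfl fun a _ => ?_
  rw [← Finset.sum_neg_distrib]
  exact Finset.sum_congr rfl fun b _ => pair_skew _ _

lemma mpair_mul : mpair (X * Y) Z = mpair X (Y * Z) + mpair Y (Z * X) := by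
  have h1 : mpair (X * Y) Z = ∑ b, ∑ a, ∑ c,
      (pair (X b c) (Y c a * Z a b) + pair (Y c a) (Z a b * X b c)) := by
    simp only [mpair, Matrix.mul_apply, map_sum, LinearMap.sum_apply, pair_mul,
      mul_comm (X _ _) (Z _ _)]
  have h2 : mpair X (Y * Z) = ∑ b, ∑ a, ∑ c, pair (X b c) (Y c a * Z a b) := by
    simp only [mpair, Matrix.mul_apply, map_sum]
    exact Finset.sum_congr rfl fun b _ => Finset.sum_comm
  have h3 : mpair Y (Z * X) = ∑ b, ∑ a, ∑ c, pair (Y c a) (Z a b * X b c) := by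
    simp only [mpair, Matrix.mul_apply, map_sum]
    calc _ = ∑ c, ∑ b, ∑ a, pair (Y c a) (Z a b * X b c) :=
          Finset.sum_congr rfl fun c _ => Finset.sum_comm
      _ = ∑ b, ∑ c, ∑ a, pair (Y c a) (Z a b * X b c) := Finset.sum_comm
      _ = _ := Finset.sum_congr rfl fun b _ => Finset.sum_comm
  rw [h1, h2, h3]
  simp only [Finset.sum_add_distrib]

lemma actK_mpair (u : Der ν) : actK u (mpair X Y) = mpair (X.map u) Y + mpair X (Y.map u) := by
  simp [mpair, actK_pair, Finset.sum_add_distrib]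

end mpair

/-- The cocycle `φ₁(t^m dₐ, t^n d_b) = - nₐ m_b ∑_p m_p t^{m+n} k_p`. -/
def cocycle₁ {ν : ℕ} (u v : Der ν) : Ker ν := - mpair (jac u) (jac v)

/-- The cocycle `φ₂(t^m dₐ, t^n d_b) = mₐ n_b ∑_p m_p t^{m+n} k_p`. -/
def cocycle₂ {ν : ℕ} (u v : Der ν) : Ker ν := pair (dvg u) (dvg v)

/-- The linear combination `φ = c₁ φ₁ + c₂ φ₂`. -/
def cocycle {ν : ℕ} (c₁ c₂ : ℂ) (u v : Der ν) : Ker ν := c₁ • cocycle₁ u v + c₂ • cocycle₂ u v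

section cocycle

variable {ν : ℕ} (c₁ c₂ : ℂ) (u u' v w : Der ν)

lemma jac_add : jac (u + u') = jac u + jac u' := by
  ext1 b a; simp [jac, coef_add]

lemma dvg_add : dvg (u + u') = dvg u + dvg u' := by
  simp [dvg, coef_add, Finset.sum_add_distrib]

lemma jac_smul (c : ℂ) : jac (c • u) = c • jac u := by
  ext1 b a; simp [jac, coef_smul]

lemma dvg_smul (c : ℂ) : dvg (c • u) = c • dvg u := by
  simp [dvg, coef_smul, Finset.smul_sum]

lemma cocycle_skew : cocycle c₁ c₂ u v = - cocycle c₁ c₂ v u := by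
  simp only [cocycle, cocycle₁, cocycle₂]
  rw [mpair_skew, pair_skew (dvg u)]
  simp only [smul_neg, neg_add]

lemma cocycle_add_left : cocycle c₁ c₂ (u + u') v = cocycle c₁ c₂ u v + cocycle c₁ c₂ u' v := by
  simp only [cocycle, cocycle₁, cocycle₂, jac_add, dvg_add, mpair_add_left, map_add,
    LinearMap.add_apply, smul_add, neg_add]
  abel

lemma cocycle_add_right : cocycle c₁ c₂ v (u + u') = cocycle c₁ c₂ v u + cocycle c₁ c₂ v u' := by
  rw [cocycle_skew, cocycle_add_left, cocycle_skew c₁ c₂ v u, cocycle_skew c₁ c₂ v u', neg_add]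

lemma cocycle_smul_right (c : ℂ) : cocycle c₁ c₂ v (c • u) = c • cocycle c₁ c₂ v u := by
  have : mpair (jac v) (c • jac u) = c • mpair (jac v) (jac u) := by
    simp [mpair, Finset.smul_sum]
  simp only [cocycle, cocycle₁, cocycle₂, jac_smul, dvg_smul, this, map_smul, smul_add, smul_neg]
  rw [smul_comm c₁, smul_comm c₂]

lemma cocycle₁_lie : actK u (cocycle₁ v w) + cocycle₁ u ⁅v, w⁆ =
    - actK w (cocycle₁ u v) + cocycle₁ ⁅u, v⁆ w + (actK v (cocycle₁ u w) + cocycle₁ v ⁅u, w⁆) := by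
  simp only [cocycle₁, map_neg, actK_mpair, jac_lie, mpair_add_left, mpair_add_right,
    mpair_sub_left, mpair_sub_right, mpair_mul]
  rw [mpair_skew ((jac u).map w) (jac v), mpair_skew ((jac v).map u) (jac w),
    mpair_skew ((jac u).map v) (jac w)]
  abel

lemma cocycle₂_lie : actK u (cocycle₂ v w) + cocycle₂ u ⁅v, w⁆ =
    - actK w (cocycle₂ u v) + cocycle₂ ⁅u, v⁆ w + (actK v (cocycle₂ u w) + cocycle₂ v ⁅u, w⁆) := by
  simp only [cocycle₂, actK_pair, dvg_lie, map_sub, LinearMap.sub_apply]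
  rw [pair_skew (w (dvg u)) (dvg v)]
  abel

lemma cocycle_lie : actK u (cocycle c₁ c₂ v w) + cocycle c₁ c₂ u ⁅v, w⁆ =
    - actK w (cocycle c₁ c₂ u v) + cocycle c₁ c₂ ⁅u, v⁆ w +
      (actK v (cocycle c₁ c₂ u w) + cocycle c₁ c₂ v ⁅u, w⁆) := by
  have h1 := congrArg (c₁ • ·) (cocycle₁_lie u v w)
  have h2 := congrArg (c₂ • ·) (cocycle₂_lie u v w)
  simp only [smul_add, smul_neg] at h1 h2
  simp only [cocycle, map_add, map_smul, neg_add]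
  have := congrArg₂ (· + ·) h1 h2
  convert this using 1 <;> abel

end cocycle

/-! ### The full toroidal Lie algebra -/

/-- A non-degenerate invariant symmetric bilinear form `(·|·)` on a Lie algebra. -/
structure InvariantForm (𝔤 : Type*) [LieRing 𝔤] [LieAlgebra ℂ 𝔤] where
  /-- the form -/
  form : LinearMap.BilinForm ℂ 𝔤
  symm : ∀ x y, form x y = form y x
  invariant : ∀ x y z, form ⁅x, y⁆ z = form x ⁅y, z⁆
  nondegenerate : form.Nondegenerate

/-- The multiloop algebra `𝔤 ⊗ A` with bracket `[x ⊗ f, y ⊗ g] = [x, y] ⊗ f g`; following the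
Mathlib convention for extension of scalars, `x ⊗ f` is written `f ⊗ₜ x`. -/
abbrev MultiLoop (ν : ℕ) (𝔤 : Type*) [LieRing 𝔤] [LieAlgebra ℂ 𝔤] : Type _ :=
  Laurent ν ⊗[ℂ] 𝔤

section loop

variable {𝔤 : Type*} [LieRing 𝔤] [LieAlgebra ℂ 𝔤] {ν : ℕ}

/-- The action `u (x ⊗ f) = x ⊗ u f` of a derivation of `A` on `𝔤 ⊗ A`. -/
def actLoop (u : Der ν) : MultiLoop ν 𝔤 →ₗ[ℂ] MultiLoop ν 𝔤 :=
  (u : Laurent ν →ₗ[ℂ] Laurent ν).rTensor 𝔤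

lemma actLoop_tmul (u : Der ν) (f : Laurent ν) (x : 𝔤) :
    actLoop u (f ⊗ₜ[ℂ] x) = u f ⊗ₜ[ℂ] x := rfl

lemma actLoop_add (u v : Der ν) (X : MultiLoop ν 𝔤) :
    actLoop (u + v) X = actLoop u X + actLoop v X := by
  induction X using TensorProduct.induction_on with
  | zero => simp
  | tmul f x => simp [actLoop_tmul, TensorProduct.add_tmul]
  | add X Y hX hY => simp only [map_add, hX, hY]; abel

lemma actLoop_smul (c : ℂ) (u : Der ν) (X : MultiLoop ν 𝔤) :
    actLoop (c • u) X = c • actLoop u X := by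
  induction X using TensorProduct.induction_on with
  | zero => simp
  | tmul f x => simp [actLoop_tmul, TensorProduct.smul_tmul']
  | add X Y hX hY => simp only [map_add, hX, hY, smul_add]

lemma actLoop_lie (u v : Der ν) (X : MultiLoop ν 𝔤) :
    actLoop ⁅u, v⁆ X = actLoop u (actLoop v X) - actLoop v (actLoop u X) := by
  induction X using TensorProduct.induction_on with
  | zero => simp
  | tmul f x => simp [actLoop_tmul, TensorProduct.sub_tmul, Derivation.commutator_apply]
  | add X Y hX hY => simp only [map_add, hX, hY]; abel

lemma actLoop_bracket (u : Der ν) (X Y : MultiLoop ν 𝔤) :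
    actLoop u ⁅X, Y⁆ = ⁅actLoop u X, Y⁆ + ⁅X, actLoop u Y⁆ := by
  induction X using TensorProduct.induction_on with
  | zero => simp
  | add X X' hX hX' => simp only [map_add, add_lie, hX, hX']; abel
  | tmul f x =>
    induction Y using TensorProduct.induction_on with
    | zero => simp
    | add Y Y' hY hY' => simp only [map_add, lie_add, hY, hY']; abel
    | tmul g y =>
      simp only [actLoop_tmul, LieAlgebra.ExtendScalars.bracket_tmul, Derivation.leibniz,
        smul_eq_mul, TensorProduct.add_tmul]
      rw [add_comm, mul_comm g]

/-- The `𝒦`-valued cocycle `(x ⊗ f, y ⊗ g) ↦ (x|y) ∑_p d_p(f) g k_p` on `𝔤 ⊗ A`. -/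
def loopCocycle (κ : InvariantForm 𝔤) : MultiLoop ν 𝔤 →ₗ[ℂ] MultiLoop ν 𝔤 →ₗ[ℂ] Ker ν :=
  (TensorProduct.map₂ pair κ.form).compr₂ (TensorProduct.rid ℂ (Ker ν)).toLinearMap

variable (κ : InvariantForm 𝔤)

lemma loopCocycle_tmul (f g : Laurent ν) (x y : 𝔤) :
    loopCocycle κ (f ⊗ₜ[ℂ] x) (g ⊗ₜ[ℂ] y) = κ.form x y • pair f g := by
  simp [loopCocycle]

lemma loopCocycle_skew (X Y : MultiLoop ν 𝔤) : loopCocycle κ X Y = - loopCocycle κ Y X := by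
  induction X using TensorProduct.induction_on with
  | zero => simp
  | add X X' hX hX' => simp only [map_add, LinearMap.add_apply, hX, hX', neg_add]
  | tmul f x =>
    induction Y using TensorProduct.induction_on with
    | zero => simp
    | add Y Y' hY hY' => simp only [map_add, LinearMap.add_apply, hY, hY', neg_add]
    | tmul g y => rw [loopCocycle_tmul, loopCocycle_tmul, pair_skew, κ.symm, smul_neg]

lemma actK_loopCocycle (u : Der ν) (X Y : MultiLoop ν 𝔤) :
    actK u (loopCocycle κ X Y) =
      loopCocycle κ (actLoop u X) Y + loopCocycle κ X (actLoop u Y) := by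
  induction X using TensorProduct.induction_on with
  | zero => simp
  | add X X' hX hX' => simp only [map_add, LinearMap.add_apply, hX, hX']; abel
  | tmul f x =>
    induction Y using TensorProduct.induction_on with
    | zero => simp
    | add Y Y' hY hY' => simp only [map_add, hY, hY']; abel
    | tmul g y =>
      simp only [actLoop_tmul, loopCocycle_tmul, map_smul, actK_pair, smul_add]

lemma loopCocycle_lie (X Y Z : MultiLoop ν 𝔤) :
    loopCocycle κ X ⁅Y, Z⁆ = loopCocycle κ ⁅X, Y⁆ Z + loopCocycle κ Y ⁅X, Z⁆ := by
  induction X using TensorProduct.induction_on with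
  | zero => simp
  | add X X' hX hX' => simp only [map_add, LinearMap.add_apply, add_lie, hX, hX']; abel
  | tmul f x =>
    induction Y using TensorProduct.induction_on with
    | zero => simp
    | add Y Y' hY hY' => simp only [map_add, LinearMap.add_apply, add_lie, lie_add, hY, hY']; abel
    | tmul g y =>
      induction Z using TensorProduct.induction_on with
      | zero => simp
      | add Z Z' hZ hZ' => simp only [map_add, lie_add, hZ, hZ']; abel
      | tmul h z =>
        simp only [LieAlgebra.ExtendScalars.bracket_tmul, loopCocycle_tmul, pair_mul]
        have h1 : κ.form y ⁅x, z⁆ = - κ.form x ⁅y, z⁆ := by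
          rw [← κ.invariant, ← lie_skew, map_neg, LinearMap.neg_apply, κ.invariant]
        rw [h1, κ.invariant, smul_add, neg_smul]
        abel

end loop

/-- The full toroidal Lie algebra `τ = 𝔤 ⊗ A ⊕ 𝒦 ⊕ 𝒟` attached to `𝔤`, the form `(·|·)` and the
cocycle `φ = c₁ φ₁ + c₂ φ₂`. -/
@[ext]
structure FullToroidal {𝔤 : Type*} [LieRing 𝔤] [LieAlgebra ℂ 𝔤] (κ : InvariantForm 𝔤) (ν : ℕ)
    (c₁ c₂ : ℂ) where
  /-- component in `𝔤 ⊗ A` -/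
  loop : MultiLoop ν 𝔤
  /-- component in `𝒦` -/
  cen : Ker ν
  /-- component in `𝒟` -/
  der : Der ν

namespace FullToroidal

variable {𝔤 : Type*} [LieRing 𝔤] [LieAlgebra ℂ 𝔤] {κ : InvariantForm 𝔤} {ν : ℕ} {c₁ c₂ : ℂ}

/-- As a set, `τ` is the product of its three components. -/
def toProd : FullToroidal κ ν c₁ c₂ ≃ MultiLoop ν 𝔤 × Ker ν × Der ν where
  toFun x := (x.loop, x.cen, x.der)
  invFun y := ⟨y.1, y.2.1, y.2.2⟩
  left_inv _ := rfl
  right_inv _ := rfl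

instance : AddCommGroup (FullToroidal κ ν c₁ c₂) := toProd.addCommGroup

instance : Module ℂ (FullToroidal κ ν c₁ c₂) := toProd.module ℂ

@[simp] lemma loop_zero : (0 : FullToroidal κ ν c₁ c₂).loop = 0 := rfl
@[simp] lemma cen_zero : (0 : FullToroidal κ ν c₁ c₂).cen = 0 := rfl
@[simp] lemma der_zero : (0 : FullToroidal κ ν c₁ c₂).der = 0 := rfl
@[simp] lemma loop_add (x y : FullToroidal κ ν c₁ c₂) : (x + y).loop = x.loop + y.loop := rfl
@[simp] lemma cen_add (x y : FullToroidal κ ν c₁ c₂) : (x + y).cen = x.cen + y.cen := rfl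
@[simp] lemma der_add (x y : FullToroidal κ ν c₁ c₂) : (x + y).der = x.der + y.der := rfl
@[simp] lemma loop_smul (c : ℂ) (x : FullToroidal κ ν c₁ c₂) : (c • x).loop = c • x.loop := rfl
@[simp] lemma cen_smul (c : ℂ) (x : FullToroidal κ ν c₁ c₂) : (c • x).cen = c • x.cen := rfl
@[simp] lemma der_smul (c : ℂ) (x : FullToroidal κ ν c₁ c₂) : (c • x).der = c • x.der := rfl

@[simp] lemma loop_sub (x y : FullToroidal κ ν c₁ c₂) : (x - y).loop = x.loop - y.loop := rfl
@[simp] lemma cen_sub (x y : FullToroidal κ ν c₁ c₂) : (x - y).cen = x.cen - y.cen := rfl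
@[simp] lemma der_sub (x y : FullToroidal κ ν c₁ c₂) : (x - y).der = x.der - y.der := rfl

instance : Bracket (FullToroidal κ ν c₁ c₂) (FullToroidal κ ν c₁ c₂) where
  bracket x y :=
    { loop := ⁅x.loop, y.loop⁆ + actLoop x.der y.loop - actLoop y.der x.loop
      cen := loopCocycle κ x.loop y.loop + actK x.der y.cen - actK y.der x.cen
        + cocycle c₁ c₂ x.der y.der
      der := ⁅x.der, y.der⁆ }

lemma loop_lie (x y : FullToroidal κ ν c₁ c₂) :
    ⁅x, y⁆.loop = ⁅x.loop, y.loop⁆ + actLoop x.der y.loop - actLoop y.der x.loop := rfl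

lemma cen_lie (x y : FullToroidal κ ν c₁ c₂) :
    ⁅x, y⁆.cen = loopCocycle κ x.loop y.loop + actK x.der y.cen - actK y.der x.cen
        + cocycle c₁ c₂ x.der y.der := rfl

lemma der_lie (x y : FullToroidal κ ν c₁ c₂) : ⁅x, y⁆.der = ⁅x.der, y.der⁆ := rfl

lemma eq_zero_of_eq_neg {M : Type*} [AddCommGroup M] [Module ℂ M] {v : M} (h : v = - v) :
    v = 0 := by
  have h2 : (2 : ℂ) • v = 0 := by
    rw [two_smul]; nth_rewrite 2 [h]; exact add_neg_cancel v
  exact (smul_eq_zero.mp h2).resolve_left two_ne_zero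

instance : LieRing (FullToroidal κ ν c₁ c₂) where
  add_lie x y z := by
    ext1
    · simp only [loop_lie, loop_add, der_add, add_lie, actLoop_add, map_add]; abel
    · simp only [cen_lie, loop_add, der_add, cen_add, actK_add, map_add, LinearMap.add_apply,
        cocycle_add_left]
      abel
    · simp only [der_lie, der_add, add_lie]
  lie_add x y z := by
    ext1
    · simp only [loop_lie, loop_add, der_add, lie_add, actLoop_add, map_add]; abel
    · simp only [cen_lie, loop_add, der_add, cen_add, actK_add, map_add, cocycle_add_right]
      abel
    · simp only [der_lie, der_add, lie_add]
  lie_self x := by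
    ext1
    · simp [loop_lie]
    · have h1 := eq_zero_of_eq_neg (loopCocycle_skew κ x.loop x.loop)
      have h2 := eq_zero_of_eq_neg (cocycle_skew c₁ c₂ x.der x.der)
      simp [cen_lie, h1, h2]
    · simp [der_lie]
  leibniz_lie x y z := by
    ext1
    · simp only [loop_lie, loop_add, der_lie, lie_add, add_lie, lie_sub, sub_lie, actLoop_lie,
        map_add, map_sub, actLoop_bracket]
      rw [leibniz_lie x.loop y.loop z.loop, ← lie_skew (actLoop z.der x.loop) y.loop]
      abel
    · simp only [cen_lie, loop_lie, cen_add, der_lie, map_add, map_sub, LinearMap.add_apply,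
        LinearMap.sub_apply, actK_lie, actK_loopCocycle]
      rw [loopCocycle_lie κ x.loop y.loop z.loop,
        loopCocycle_skew κ (actLoop z.der x.loop) y.loop]
      have h := cocycle_lie c₁ c₂ x.der y.der z.der
      rw [← sub_eq_zero] at h ⊢
      rw [← h]
      abel
    · simp only [der_lie, der_add]
      exact leibniz_lie _ _ _

instance : LieAlgebra ℂ (FullToroidal κ ν c₁ c₂) where
  lie_smul c x y := by
    ext1
    · simp only [loop_lie, loop_smul, der_smul, lie_smul, actLoop_smul, map_smul, smul_add,
        smul_sub]
    · simp only [cen_lie, cen_smul, loop_smul, der_smul, actK_smul, map_smul, smul_add,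
        smul_sub, cocycle_smul_right]
    · simp only [der_lie, der_smul, lie_smul]

/-- The inclusion `𝔤 ⊗ A → τ`. -/
def ofLoop : MultiLoop ν 𝔤 →ₗ[ℂ] FullToroidal κ ν c₁ c₂ where
  toFun X := ⟨X, 0, 0⟩
  map_add' X Y := by ext1 <;> simp
  map_smul' c X := by ext1 <;> simp

/-- The inclusion `𝒦 → τ`. -/
def ofKer : Ker ν →ₗ[ℂ] FullToroidal κ ν c₁ c₂ where
  toFun w := ⟨0, w, 0⟩
  map_add' X Y := by ext1 <;> simp
  map_smul' c X := by ext1 <;> simp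

/-- The inclusion `𝒟 → τ`. -/
def ofDer : Der ν →ₗ[ℂ] FullToroidal κ ν c₁ c₂ where
  toFun u := ⟨0, 0, u⟩
  map_add' X Y := by ext1 <;> simp
  map_smul' c X := by ext1 <;> simp

/-- The element `x ⊗ t^m` of `τ`. -/
def xt (x : 𝔤) (m : Fin (ν + 1) → ℤ) : FullToroidal κ ν c₁ c₂ := ofLoop (mono m ⊗ₜ[ℂ] x)

/-- The element `t^m k_p` of `τ`. -/
def tk (m : Fin (ν + 1) → ℤ) (p : Fin (ν + 1)) : FullToroidal κ ν c₁ c₂ := ofKer (kEl p (mono m))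

/-- The element `t^m d_a` of `τ`. -/
def td (m : Fin (ν + 1) → ℤ) (a : Fin (ν + 1)) : FullToroidal κ ν c₁ c₂ := ofDer (mono m • deg a)

/-! The defining relations of `τ` on the spanning elements. -/

section relations

variable (x y : 𝔤) (m n : Fin (ν + 1) → ℤ) (a b p q : Fin (ν + 1))

lemma sum_tk : ∑ p, (m p : ℂ) • (tk m p : FullToroidal κ ν c₁ c₂) = 0 := by
  have h : ∑ p, (m p : ℂ) • kEl p (mono m) = 0 := by
    simp only [← map_smul]
    rw [← mkQ_eq_sum (fun p => (m p : ℂ) • mono m), Submodule.mkQ_apply,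
      Submodule.Quotient.mk_eq_zero]
    exact Submodule.subset_span ⟨m, rfl⟩
  have h2 : ∑ p, (m p : ℂ) • (tk m p : FullToroidal κ ν c₁ c₂) =
      ofKer (∑ p, (m p : ℂ) • kEl p (mono m)) := by
    simp only [tk, map_sum, map_smul]
  rw [h2, h, map_zero]

lemma pair_mono : pair (mono m) (mono n) = ∑ p, (m p : ℂ) • kEl p (mono (m + n)) := by
  simp [pair_apply, deg_mono, mono_mul]

lemma lie_xt_xt : ⁅(xt x m : FullToroidal κ ν c₁ c₂), (xt y n : FullToroidal κ ν c₁ c₂)⁆ =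
    xt ⁅x, y⁆ (m + n) + κ.form x y • ∑ p, (m p : ℂ) • tk (m + n) p := by
  have h : actLoop (0 : Der ν) = (0 : MultiLoop ν 𝔤 →ₗ[ℂ] MultiLoop ν 𝔤) := by
    ext; simp [actLoop]
  have h' : (κ.form x y • ∑ p, (m p : ℂ) • tk (m + n) p : FullToroidal κ ν c₁ c₂) =
      ofKer (loopCocycle κ (mono m ⊗ₜ[ℂ] x) (mono n ⊗ₜ[ℂ] y)) := by
    simp only [loopCocycle_tmul, pair_mono, map_smul, map_sum, tk]
  rw [h']
  ext1
  · simp [loop_lie, xt, ofLoop, ofKer, h, mono_mul]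
  · simp [cen_lie, xt, ofLoop, ofKer, cocycle, cocycle₁, cocycle₂, mpair, jac, dvg, coef]
  · simp [der_lie, xt, ofLoop, ofKer]

lemma lie_td_xt : ⁅(td m a : FullToroidal κ ν c₁ c₂), (xt x n : FullToroidal κ ν c₁ c₂)⁆ =
    (n a : ℂ) • xt x (m + n) := by
  ext1
  · simp [loop_lie, xt, td, ofLoop, ofDer, actLoop_tmul, deg_mono, mono_mul,
      TensorProduct.smul_tmul']
  · simp [cen_lie, xt, td, ofLoop, ofDer, cocycle, cocycle₁, cocycle₂, mpair, jac, dvg, coef]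
  · simp [der_lie, xt, td, ofLoop, ofDer]

lemma actK_td : actK (mono m • deg a) (kEl b (mono n)) =
    (n a : ℂ) • kEl b (mono (m + n)) +
      if a = b then ∑ p, (m p : ℂ) • kEl p (mono (m + n)) else 0 := by
  have h : actK (mono m • deg a) (kEl b (mono n)) =
      (relK ν).mkQ (lieForm (mono m • deg a) (Pi.single b (mono n))) := rfl
  rw [h, mkQ_eq_sum]
  simp only [lieForm_apply, coef_smul_deg, map_add, Finset.sum_add_distrib]
  congr 1
  · rw [Finset.sum_eq_single b]
    · simp [deg_mono, mono_mul]
    · intro q _ hq; simp [hq]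
    · simp
  · by_cases hab : a = b
    · subst hab
      simp only [if_true]
      refine Finset.sum_congr rfl fun q _ => ?_
      rw [Finset.sum_eq_single a]
      · simp [deg_mono, mono_mul, add_comm n m]
      · intro c _ hc; simp [hc]
      · simp
    · rw [if_neg hab]
      refine Finset.sum_eq_zero fun q _ => ?_
      rw [Finset.sum_eq_zero, map_zero]
      intro c _
      by_cases hc : c = b
      · subst hc; simp [hab]
      · simp [hc]

lemma lie_td_tk : ⁅(td m a : FullToroidal κ ν c₁ c₂), (tk n b : FullToroidal κ ν c₁ c₂)⁆ =
    (n a : ℂ) • tk (m + n) b + if a = b then ∑ p, (m p : ℂ) • tk (m + n) p else 0 := by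
  have h' : ((n a : ℂ) • tk (m + n) b +
      (if a = b then ∑ p, (m p : ℂ) • tk (m + n) p else 0) : FullToroidal κ ν c₁ c₂) =
      ofKer (actK (mono m • deg a) (kEl b (mono n))) := by
    rw [actK_td]
    split_ifs <;> simp [tk]
  rw [h']
  ext1
  · simp [loop_lie, tk, td, ofKer, ofDer]
  · simp [cen_lie, tk, td, ofKer, ofDer, cocycle, cocycle₁, cocycle₂, mpair, jac, dvg, coef]
  · simp [der_lie, tk, td, ofKer, ofDer]

lemma cocycle₁_td : cocycle₁ (mono m • deg a) (mono n • deg b) =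
    -((n a : ℂ) * (m b : ℂ)) • ∑ p, (m p : ℂ) • kEl p (mono (m + n)) := by
  have h : ∀ (r : Fin (ν + 1) → ℤ) (c i j : Fin (ν + 1)), jac (mono r • deg c) i j =
      if c = j then (r i : ℂ) • mono r else 0 := by
    intro r c i j
    simp only [jac, coef_smul_deg]
    split_ifs
    · exact deg_mono _ _
    · simp
  rw [← pair_mono, cocycle₁, mpair, Finset.sum_eq_single b, Finset.sum_eq_single a]
  · simp [h, smul_smul, mul_comm]
  · intro c _ hc; simp [h, Ne.symm hc]
  · simp
  · intro c _ hc; simp [h, Ne.symm hc]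
  · simp

lemma cocycle₂_td : cocycle₂ (mono m • deg a) (mono n • deg b) =
    ((m a : ℂ) * (n b : ℂ)) • ∑ p, (m p : ℂ) • kEl p (mono (m + n)) := by
  have h : ∀ (r : Fin (ν + 1) → ℤ) (c : Fin (ν + 1)), dvg (mono r • deg c) =
      (r c : ℂ) • mono r := by
    intro r c
    rw [dvg, Finset.sum_eq_single c]
    · simp [coef_smul_deg, deg_mono]
    · intro d _ hd; simp [coef_smul_deg, Ne.symm hd]
    · simp
  rw [← pair_mono, cocycle₂, h, h]
  simp [smul_smul, mul_comm]

lemma lie_td_td : ⁅(td m a : FullToroidal κ ν c₁ c₂), (td n b : FullToroidal κ ν c₁ c₂)⁆ =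
    (n a : ℂ) • td (m + n) b - (m b : ℂ) • td (m + n) a +
      (c₁ * -((n a : ℂ) * (m b : ℂ)) + c₂ * ((m a : ℂ) * (n b : ℂ))) •
        ∑ p, (m p : ℂ) • tk (m + n) p := by
  have h' : ((c₁ * -((n a : ℂ) * (m b : ℂ)) + c₂ * ((m a : ℂ) * (n b : ℂ))) •
        ∑ p, (m p : ℂ) • tk (m + n) p : FullToroidal κ ν c₁ c₂) =
      ofKer (cocycle c₁ c₂ (mono m • deg a) (mono n • deg b)) := by
    rw [cocycle, cocycle₁_td, cocycle₂_td, smul_smul, smul_smul, ← add_smul]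
    simp [tk]
  rw [h']
  ext1
  · simp [loop_lie, td, ofKer, ofDer]
  · simp [cen_lie, td, ofKer, ofDer]
  · simp only [der_lie, td, ofKer, ofDer, LinearMap.coe_mk, AddHom.coe_mk, der_add, der_sub, der_smul,
      add_zero]
    ext1 f
    simp only [Derivation.commutator_apply, Derivation.smul_apply, Derivation.sub_apply,
      Derivation.leibniz, deg_mono, smul_eq_mul, deg_comm a b f, ← mono_mul m n]
    simp only [Algebra.smul_def]
    ring

lemma lie_xt_tk : ⁅(xt x m : FullToroidal κ ν c₁ c₂), (tk n p : FullToroidal κ ν c₁ c₂)⁆ = 0 := by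
  have h : actLoop (0 : Der ν) = (0 : MultiLoop ν 𝔤 →ₗ[ℂ] MultiLoop ν 𝔤) := by
    ext; simp [actLoop]
  have h0 : ∀ w : Ker ν, actK (0 : Der ν) w = 0 := fun w => by
    have := actK_smul 0 (0 : Der ν) w
    simpa using this
  ext1
  · simp [loop_lie, xt, tk, ofLoop, ofKer, h]
  · simp [cen_lie, xt, tk, ofLoop, ofKer, h0, cocycle, cocycle₁, cocycle₂, mpair, jac, dvg, coef]
  · simp [der_lie, xt, tk, ofLoop, ofKer]

lemma lie_tk_tk : ⁅(tk m p : FullToroidal κ ν c₁ c₂), (tk n q : FullToroidal κ ν c₁ c₂)⁆ = 0 := by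
  have h0 : ∀ w : Ker ν, actK (0 : Der ν) w = 0 := fun w => by
    have := actK_smul 0 (0 : Der ν) w
    simpa using this
  ext1
  · simp [loop_lie, tk, ofKer]
  · simp [cen_lie, tk, ofKer, h0, cocycle, cocycle₁, cocycle₂, mpair, jac, dvg, coef]
  · simp [der_lie, tk, ofKer]

end relations

/-- The Cartan subalgebra `𝔥 = 𝔥̇ ⊕ ⨁ ℂ k_i ⊕ ⨁ ℂ d_i` of `τ`, where `𝔥̇ = H` is a Cartan
subalgebra of `𝔤`, embedded as `H ⊗ 1`. -/
def cartan (κ : InvariantForm 𝔤) (ν : ℕ) (c₁ c₂ : ℂ) (H : LieSubalgebra ℂ 𝔤) :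
    Submodule ℂ (FullToroidal κ ν c₁ c₂) :=
  Submodule.span ℂ {z | ∃ h ∈ H, z = xt h 0} ⊔
    (Submodule.span ℂ (Set.range fun p : Fin (ν + 1) => tk 0 p) ⊔
      Submodule.span ℂ (Set.range fun a : Fin (ν + 1) => td 0 a))

/-- The inclusion `𝔥̇ → 𝔥`, `h ↦ h ⊗ 1`. -/
def finCartan (κ : InvariantForm 𝔤) (ν : ℕ) (c₁ c₂ : ℂ) (H : LieSubalgebra ℂ 𝔤) :
    H →ₗ[ℂ] cartan κ ν c₁ c₂ H where
  toFun h := ⟨xt h 0, Submodule.mem_sup_left (Submodule.subset_span ⟨h, h.2, rfl⟩)⟩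
  map_add' h h' := by ext1; simp [xt, TensorProduct.tmul_add]
  map_smul' c h := by ext1; simp [xt]

end FullToroidal

open FullToroidal

/-! ### Integrable modules for the map full toroidal Lie algebra -/

/-- The map full toroidal Lie algebra `τ(B) = τ ⊗ B` with bracket
`[x ⊗ b, y ⊗ b'] = [x, y] ⊗ b b'`; following the Mathlib convention for extension of scalars,
`x ⊗ b` is written `b ⊗ₜ x`. -/
abbrev MapFullToroidal {𝔤 : Type*} [LieRing 𝔤] [LieAlgebra ℂ 𝔤] (κ : InvariantForm 𝔤) (ν : ℕ)
    (c₁ c₂ : ℂ) (B : Type*) [CommRing B] [Algebra ℂ B] : Type _ :=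
  B ⊗[ℂ] FullToroidal κ ν c₁ c₂

section modules

variable {𝔤 : Type*} [LieRing 𝔤] [LieAlgebra ℂ 𝔤] (κ : InvariantForm 𝔤) (ν : ℕ) (c₁ c₂ : ℂ)
  (B : Type*) [CommRing B] [Algebra ℂ B] (H : LieSubalgebra ℂ 𝔤)
  (V : Type*) [AddCommGroup V] [Module ℂ V] [LieRingModule (MapFullToroidal κ ν c₁ c₂ B) V]
  [LieModule ℂ (MapFullToroidal κ ν c₁ c₂ B) V]

/-- The weight space `V_χ = {v | h v = χ(h) v for all h ∈ 𝔥}`, with `𝔥` acting through `𝔥 ⊗ 1`. -/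
def weightSpace (χ : Module.Dual ℂ (cartan κ ν c₁ c₂ H)) : Submodule ℂ V where
  carrier := {v | ∀ h : cartan κ ν c₁ c₂ H,
    ⁅((1 : B) ⊗ₜ[ℂ] (h : FullToroidal κ ν c₁ c₂) : MapFullToroidal κ ν c₁ c₂ B), v⁆ = χ h • v}
  zero_mem' := fun h => by rw [lie_zero, smul_zero]
  add_mem' := fun {v w} hv hw h => by rw [lie_add, hv h, hw h, smul_add]
  smul_mem' := fun c v hv h => by rw [lie_smul, hv h, smul_comm]

open Classical in
/-- Integrable `τ(B)`-modules: `V` is the direct sum of its `𝔥`-weight spaces, and the elements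
`x ⊗ t^m ⊗ b` with `x` in a root space of `𝔤` act locally nilpotently. -/
structure IsIntegrable [H.IsCartanSubalgebra] : Prop where
  weight : DirectSum.IsInternal fun χ : Module.Dual ℂ (cartan κ ν c₁ c₂ H) =>
    weightSpace κ ν c₁ c₂ B H V χ
  locallyNilpotent : ∀ α : LieModule.Weight ℂ H 𝔤, α.IsNonZero →
    ∀ x ∈ LieAlgebra.rootSpace H α, ∀ (m : Fin (ν + 1) → ℤ) (b : B) (v : V), ∃ N : ℕ,
      ((LieModule.toEnd ℂ (MapFullToroidal κ ν c₁ c₂ B) V (b ⊗ₜ[ℂ] xt x m)) ^ N) v = 0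

/-- The category `𝒞_fin` of integrable modules with finite-dimensional weight spaces. -/
structure InCfin [H.IsCartanSubalgebra] : Prop where
  integrable : IsIntegrable κ ν c₁ c₂ B H V
  finiteDimensional : ∀ χ : Module.Dual ℂ (cartan κ ν c₁ c₂ H),
    FiniteDimensional ℂ (weightSpace κ ν c₁ c₂ B H V χ)

/-- The central charges of `V` vanish: `k_p ⊗ 1` acts by zero for all `p`. -/
def ZeroCentralCharge : Prop :=
  ∀ (p : Fin (ν + 1)) (v : V),
    ⁅((1 : B) ⊗ₜ[ℂ] tk 0 p : MapFullToroidal κ ν c₁ c₂ B), v⁆ = 0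

end modules

section top

variable {𝔤 : Type*} [LieRing 𝔤] [LieAlgebra ℂ 𝔤] [FiniteDimensional ℂ 𝔤]
  [LieAlgebra.IsSimple ℂ 𝔤] {H : LieSubalgebra ℂ 𝔤} [H.IsCartanSubalgebra]

/-- `𝔤₊`, the sum of the root spaces of the roots that are positive with respect to the base `Δ`. -/
def posPart (Δ : (LieAlgebra.IsKilling.rootSystem H).Base) : Submodule ℂ 𝔤 :=
  ⨆ α : {α : H.root // Δ.IsPos α}, (LieAlgebra.rootSpace H (α : H.root).1).toSubmodule

/-- The top space `T = {v | (𝔤₊ ⊗ A ⊗ B) v = 0}`. -/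
def topSpace (κ : InvariantForm 𝔤) (ν : ℕ) (c₁ c₂ : ℂ) (B : Type*) [CommRing B] [Algebra ℂ B]
    (Δ : (LieAlgebra.IsKilling.rootSystem H).Base)
    (V : Type*) [AddCommGroup V] [Module ℂ V] [LieRingModule (MapFullToroidal κ ν c₁ c₂ B) V]
    [LieModule ℂ (MapFullToroidal κ ν c₁ c₂ B) V] : Submodule ℂ V where
  carrier := {v | ∀ x ∈ posPart Δ, ∀ (f : Laurent ν) (b : B),
    ⁅(b ⊗ₜ[ℂ] ofLoop (f ⊗ₜ[ℂ] x) : MapFullToroidal κ ν c₁ c₂ B), v⁆ = 0}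
  zero_mem' := fun x _ f b => lie_zero _
  add_mem' := fun {v w} hv hw x hx f b => by rw [lie_add, hv x hx f b, hw x hx f b, add_zero]
  smul_mem' := fun c v hv x hx f b => by rw [lie_smul, hv x hx f b, smul_zero]

end top

end MapToroidal
end

noncomputable section

namespace MapToroidal

/-! ### Nilpotency of linear operators -/

section nilpotency

variable {E : Type*} [Ring E]

/-! The argument shows that `𝒦 ⊗ B` kills one nonzero vector; by irreducibility it then acts by zero
on all of `V`. Such a vector exists once the operators `t_a k_q`, `a ≠ q`, are nilpotent on a
suitable part of `T`, and this nilpotency is forced by a trace argument.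

Boundedness. Choose a positive root `α` with `Λ(α^∨) ≠ 0` and an `sl₂`-triple `e, h, f` for it. At
level zero, `e ⊗ t^n` undoes `f ⊗ t^{-n}` on the part of `T` of weight `Λ + ∑ nₐ δₐ`, up to the
scalar `Λ(α^∨)`. All these parts thus embed in the one finite-dimensional space `V_{Λ - α}`
(`exists_finrank_topWeightSpace_le`).

Trace. For `h, h'` in the Cartan subalgebra with `(h|h') ≠ 0`, the operators `X = h ⊗ t_q^j` and `Y
= h' ⊗ t^s t_q^{-j}` have commutator a nonzero multiple of `z = t^s k_q`. With `z' = t^s t_q^j k_q`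
and `a = z z'`, the operators `X z²` and `Y z'³` have once and twice the degree of `a`, and their
commutator is a nonzero multiple of `a³`. Were `a` not nilpotent, bounded dimension would give a
nonzero image of a power of `a` on which one can divide by `a` and `a²`; there a commutator would be
a nonzero scalar, which the trace forbids (`pow_apply_eq_zero_of_commutator`).

Derivations. Put `Z_j = t_a t_q^j k_q`. The products `Z_i Z_j`, `i ≠ j`, are now nilpotent.
Commutation with `t_q^{-1} d_a` sends `Z_j` to `Z_{j-1}`, and from `Z_0 Z_1` it produces `Z_{-1} Z_1
+ Z_0²`, so `Z_0 = t_a k_q` is nilpotent (`isNilpotent_of_ladder`). The last nonvanishing power of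
`t_a k_q` supplies vectors killed by all `t^s k_q` and `t^s k_a`; iteration over the indices kills
all of `𝒦 ⊗ B` (`exists_killed`). -/

/-- Leibniz rule for the derivation `[d, ·]`, with the factors collected because `[d, w]` commutes
with `w`. -/
lemma commutator_pow {d w : E} (h : Commute w (d * w - w * d)) (n : ℕ) :
    d * w ^ n - w ^ n * d = n * (w ^ (n - 1) * (d * w - w * d)) := by
  induction n with
  | zero => simp
  | succ n ih =>
    have h1 : d * w ^ (n + 1) - w ^ (n + 1) * d =
        (d * w ^ n - w ^ n * d) * w + w ^ n * (d * w - w * d) := by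
      rw [pow_succ]; noncomm_ring
    rw [h1, ih]
    rcases n with _ | n
    · simp
    · rw [mul_assoc, mul_assoc, ← h.eq, ← mul_assoc (w ^ _) w, ← pow_succ]
      push_cast
      noncomm_ring

/-- In characteristic zero, the commutator of an arbitrary element with a nilpotent one is nilpotent
as soon as it commutes with the nilpotent element and with the second commutator. -/
lemma isNilpotent_commutator [Algebra ℂ E] {d w w' w'' : E} (hw' : w' = d * w - w * d)
    (hw'' : w'' = d * w' - w' * d) (h₁ : Commute w w') (h₂ : Commute w' w'')
    (h : IsNilpotent w) : IsNilpotent w' := by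
  obtain ⟨L, hL⟩ := h
  -- Each factor `w` is traded for two factors `w'`: one comes from differentiating `w`, the other
  -- absorbs the term in `w''`.
  have key : ∀ k ≤ L, w ^ (L - k) * w' ^ (2 * k) = 0 := by
    intro k
    induction k with
    | zero => simp [hL]
    | succ k ih =>
      intro hk
      have ih := ih (by omega)
      obtain ⟨n, hn⟩ : ∃ n, L - k = n + 1 := ⟨L - k - 1, by omega⟩
      have hn' : L - (k + 1) = n := by omega
      rw [hn] at ih
      rw [hn']
      have e1 : d * w ^ (n + 1) - w ^ (n + 1) * d = (n + 1 : ℕ) * (w ^ n * w') := by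
        rw [commutator_pow (by rw [← hw']; exact h₁), ← hw', Nat.add_sub_cancel]
      have e2 : d * w' ^ (2 * k) - w' ^ (2 * k) * d =
          (2 * k : ℕ) * (w' ^ (2 * k - 1) * w'') := by
        rw [commutator_pow (by rw [← hw'']; exact h₂), ← hw'']
      have e3 : (d * w ^ (n + 1) - w ^ (n + 1) * d) * w' ^ (2 * k) +
          w ^ (n + 1) * (d * w' ^ (2 * k) - w' ^ (2 * k) * d) = 0 := by
        have : (d * w ^ (n + 1) - w ^ (n + 1) * d) * w' ^ (2 * k) +
          w ^ (n + 1) * (d * w' ^ (2 * k) - w' ^ (2 * k) * d) =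
          d * (w ^ (n + 1) * w' ^ (2 * k)) - (w ^ (n + 1) * w' ^ (2 * k)) * d := by
          noncomm_ring
        rw [this, ih]; simp
      rw [e1, e2] at e3
      have e4 : ((n + 1 : ℕ) : E) * (w ^ n * w' ^ (2 * (k + 1))) = 0 := by
        -- Right multiplication by `w'` completes the factor `w ^ (n + 1) * w' ^ (2 * k)`, which is
        -- zero by induction. At `k = 0` the coefficient `2 * k` vanishes, so the truncated exponent
        -- is harmless.
        have e5 : w ^ (n + 1) * (((2 * k : ℕ) : E) * (w' ^ (2 * k - 1) * w'')) * w' = 0 := by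
          rcases k with _ | k
          · simp
          · have : w' ^ (2 * (k + 1) - 1) * w'' * w' = w' ^ (2 * (k + 1)) * w'' := by
              rw [mul_assoc, ← h₂.eq, ← mul_assoc, ← pow_succ]; rfl
            rw [mul_assoc, mul_assoc, this, ← mul_assoc, ← (Nat.cast_commute _ _).eq, mul_assoc,
              ← mul_assoc (w ^ _), ih]
            simp
        have e6 := congrArg (· * w') e3
        simp only [add_mul, zero_mul, e5, add_zero] at e6
        rw [← e6, show 2 * (k + 1) = 1 + 2 * k + 1 by ring, pow_succ, pow_add, pow_one]
        noncomm_ring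
      have e7 : ((n + 1 : ℕ) : ℂ) • (w ^ n * w' ^ (2 * (k + 1))) = 0 := by
        rw [Nat.cast_smul_eq_nsmul, nsmul_eq_mul, e4]
      exact (smul_eq_zero.mp e7).resolve_left (Nat.cast_ne_zero.mpr n.succ_ne_zero)
  exact ⟨2 * L, by simpa using key L le_rfl⟩

end nilpotency

/-! ### Trace obstruction and nilpotency on graded spaces of bounded dimension -/

section trace

open Module

variable {V : Type*} [AddCommGroup V] [Module ℂ V]

/-- Only on the zero space is a commutator of finite-dimensional operators a nonzero scalar. -/
lemma finrank_eq_zero_of_commutator_eq_smul [FiniteDimensional ℂ V] {A B : End ℂ V} {c : ℂ}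
    (hc : c ≠ 0) (h : A * B - B * A = c • 1) : finrank ℂ V = 0 := by
  have := congrArg (LinearMap.trace ℂ V) h
  rw [map_sub, LinearMap.trace_mul_comm, sub_self, map_smul, LinearMap.trace_one] at this
  simpa [hc] using this.symm

/-- Pigeonhole: `D` strict increases starting from at least `1` would exceed the bound `D`. -/
lemma exists_succ_eq_of_le {f : ℕ → ℕ} {D : ℕ} (h0 : 1 ≤ f 0) (hD : f D ≤ D)
    (hm : ∀ i < D, f i ≤ f (i + 1)) : ∃ i < D, f i = f (i + 1) := by
  by_contra! hne
  have : ∀ i ≤ D, i + 1 ≤ f i := by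
    intro i
    induction i with
    | zero => intro _; omega
    | succ i ih =>
      intro hi
      have h1 := ih (by omega)
      have h2 := hm i (by omega)
      have h3 := hne i (by omega)
      omega
  have := this D le_rfl
  omega

/-- If `b` maps `U` bijectively onto `U'` and `P` maps `U` into `U'`, then `P` factors on `U` as `b`
after an endomorphism of `U`. -/
lemma exists_lift_of_map_eq {U U' : Submodule ℂ V} {b P : End ℂ V} (hb : U.map b = U')
    (hinj : ∀ u ∈ U, b u = 0 → u = 0) (hP : ∀ u ∈ U, P u ∈ U') :
    ∃ A : End ℂ U, ∀ u : U, b (A u : V) = P u := by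
  let e : U →ₗ[ℂ] U' := b.restrict fun u hu => hb ▸ Submodule.mem_map_of_mem hu
  have he : Function.Bijective e := by
    refine ⟨?_, ?_⟩
    · rw [injective_iff_map_eq_zero]
      intro u hu
      exact Subtype.ext (hinj u u.2 (congrArg Subtype.val hu))
    · rintro ⟨u', hu'⟩
      obtain ⟨u, hu, rfl⟩ := hb ▸ hu'
      exact ⟨⟨u, hu⟩, rfl⟩
  let e' := LinearEquiv.ofBijective e he
  refine ⟨e'.symm.toLinearMap ∘ₗ P.restrict hP, fun u => ?_⟩
  have := e'.apply_symm_apply (P.restrict hP u)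
  exact congrArg Subtype.val this

/-- If graded pieces have dimension at most `D`, and `c a³` is a commutator of two operators of
degrees `1` and `2` that commute with the degree one operator `a`, then `a ^ (6 D) = 0`. -/
lemma pow_apply_eq_zero_of_commutator (W : ℕ → Submodule ℂ V) (D : ℕ)
    [∀ k, FiniteDimensional ℂ (W k)] (hD : ∀ k, finrank ℂ (W k) ≤ D) {a P Q : End ℂ V}
    (ha : ∀ k, ∀ v ∈ W k, a v ∈ W (k + 1)) (hP : ∀ k, ∀ v ∈ W k, P v ∈ W (k + 1))
    (hQ : ∀ k, ∀ v ∈ W k, Q v ∈ W (k + 2)) (haP : Commute a P) (haQ : Commute a Q)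
    {c : ℂ} (hc : c ≠ 0) (h : P * Q - Q * P = c • a ^ 3) :
    ∀ v ∈ W 0, (a ^ (6 * D)) v = 0 := by
  have hpow : ∀ n k, ∀ v ∈ W k, (a ^ n) v ∈ W (k + n) := by
    intro n
    induction n with
    | zero => intro k v hv; simpa using hv
    | succ n ih =>
      intro k v hv
      rw [pow_succ', Module.End.mul_apply]
      exact ha _ _ (ih k v hv)
  -- `I k n = aⁿ W_k` sits in degree `k + n`. Applying `a` more often lowers its dimension (`hcut`);
  -- trading applications of `a` for a later starting degree enlarges the space (`hshift`).
  let I : ℕ → ℕ → Submodule ℂ V := fun k n => (W k).map (a ^ n)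
  have hIle : ∀ k n, I k n ≤ W (k + n) := by
    rintro k n _ ⟨v, hv, rfl⟩
    exact hpow n k v hv
  have hIshift : ∀ k n j, I k (j + n) ≤ I (k + j) n := by
    rintro k n j _ ⟨v, hv, rfl⟩
    refine ⟨(a ^ j) v, hpow j k v hv, ?_⟩
    rw [add_comm j n, pow_add, Module.End.mul_apply]
  have hImap : ∀ k n j, (I k n).map (a ^ j) = I k (j + n) := by
    intro k n j
    simp only [I, pow_add]
    rw [Module.End.mul_eq_comp, Submodule.map_comp]
  have hcut : ∀ k n j, finrank ℂ (I k (j + n)) ≤ finrank ℂ (I k n) := by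
    intro k n j
    rw [← hImap]
    exact Submodule.finrank_map_le _ _
  have hshift : ∀ k n j, finrank ℂ (I k (j + n)) ≤ finrank ℂ (I (k + j) n) := fun k n j =>
    Submodule.finrank_mono (hIshift k n j)
  by_contra! hne
  obtain ⟨v, hv, hv0⟩ := hne
  -- One step lowers the exponent by `6`: three applications of `a` move the start from `3i` to `3i
  -- + 3`, three more are dropped. The dimension can only grow, and `D` steps exhaust the exponent
  -- `6 * D`, so it stalls at some step.
  obtain ⟨i, hi, hfi⟩ := exists_succ_eq_of_le (D := D)
    (f := fun i => finrank ℂ (I (3 * i) (6 * D - 6 * i)))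
    (by
      have : Nontrivial (I (3 * 0) (6 * D - 6 * 0)) :=
        ⟨⟨⟨_, ⟨v, by simpa using hv, rfl⟩⟩, 0, fun h0 => hv0 (by simpa using congrArg Subtype.val h0)⟩⟩
      exact finrank_pos)
    ((Submodule.finrank_mono (hIle _ _)).trans (hD _))
    (by
      intro i hi
      obtain ⟨n, hn⟩ : ∃ n, 6 * D - 6 * i = 3 + (3 + n) := ⟨6 * D - 6 * i - 6, by omega⟩
      have hn' : 6 * D - 6 * (i + 1) = n := by omega
      rw [hn, hn']
      exact (hshift _ _ _).trans (hcut _ _ _))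
  obtain ⟨n, hn⟩ : ∃ n, 6 * D - 6 * i = 3 + (3 + n) := ⟨6 * D - 6 * i - 6, by omega⟩
  have hn' : 6 * D - 6 * (i + 1) = n := by omega
  rw [hn, hn', show 3 * (i + 1) = 3 * i + 3 by ring] at hfi
  set k := 3 * i
  -- The space is nonzero because `a ^ (6 * D)` factors as `a ^ (3i)`, then `a ^ (6 + n)` on `W k`,
  -- then `a ^ (3i)` again.
  have hpos : finrank ℂ (I k (3 + n)) ≠ 0 := by
    have h1 : finrank ℂ (I k (3 + (3 + n))) ≠ 0 := by
      intro h0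
      have hbot : I k (3 + (3 + n)) = ⊥ := Submodule.finrank_eq_zero.mp h0
      apply hv0
      have : (a ^ (3 * i)) v ∈ W k := by simpa using hpow (3 * i) 0 v hv
      have h2 : (a ^ (3 + (3 + n))) ((a ^ (3 * i)) v) = 0 := by
        rw [← Submodule.mem_bot ℂ, ← hbot]
        exact Submodule.mem_map_of_mem this
      rw [show 6 * D = 3 * i + ((3 + (3 + n)) + 3 * i) by omega, pow_add, pow_add,
        Module.End.mul_apply, Module.End.mul_apply, h2, map_zero]
    have := hcut k (3 + n) 3
    omega
  -- The dimensions at `j = 0, …, 3` are squeezed between the two equal ends of the stalled step.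
  -- Hence `a ^ j` is bijective from `U = I k (3 + n)` onto `I (k + j) (3 + n)`.
  have heq : ∀ j ≤ 3, finrank ℂ (I (k + j) (3 + n)) = finrank ℂ (I k (3 + (3 + n))) := by
    intro j hj
    refine le_antisymm ?_ ?_
    · rw [hfi]
      obtain ⟨j', hj'⟩ : ∃ j', 3 = j + j' := ⟨3 - j, by omega⟩
      have h1 := hcut (k + j) (j' + n) j
      have h2 := hshift (k + j) n j'
      rw [show 3 + n = j + (j' + n) by omega, show k + 3 = k + j + j' by omega]
      exact h1.trans h2
    · obtain ⟨j', hj'⟩ : ∃ j', 3 = j + j' := ⟨3 - j, by omega⟩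
      have h1 := hcut k (j + (3 + n)) j'
      have h2 := hshift k (3 + n) j
      rw [show 3 + (3 + n) = j' + (j + (3 + n)) by omega]
      exact h1.trans h2
  have hinj3 : ∀ u ∈ I k (3 + n), (a ^ 3) u = 0 → u = 0 := by
    have hf : finrank ℂ ((I k (3 + n)).map (a ^ 3)) = finrank ℂ (I k (3 + n)) := by
      rw [hImap, ← heq 0 (by omega)]; rfl
    let g : I k (3 + n) →ₗ[ℂ] V := (a ^ 3).domRestrict _
    have hg : LinearMap.range g = (I k (3 + n)).map (a ^ 3) := by
      simp [g, LinearMap.range_domRestrict]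
    have h1 := LinearMap.finrank_range_add_finrank_ker g
    rw [hg, hf] at h1
    have h2 : LinearMap.ker g = ⊥ := Submodule.finrank_eq_zero.mp (by omega)
    intro u hu hu0
    have : (⟨u, hu⟩ : I k (3 + n)) ∈ LinearMap.ker g := hu0
    rw [h2, Submodule.mem_bot] at this
    exact congrArg Subtype.val this
  have hinj : ∀ j ≤ 3, ∀ u ∈ I k (3 + n), (a ^ j) u = 0 → u = 0 := by
    intro j hj u hu hu0
    apply hinj3 u hu
    rw [show 3 = (3 - j) + j by omega, pow_add, Module.End.mul_apply, hu0, map_zero]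
  have hmap : ∀ j ≤ 3, (I k (3 + n)).map (a ^ j) = I (k + j) (3 + n) := by
    intro j hj
    refine Submodule.eq_of_le_of_finrank_eq ?_ ?_
    · rw [hImap]; exact hIshift k (3 + n) j
    · rw [heq j hj, hImap]
      refine le_antisymm ?_ ?_
      · rw [← heq 0 (by omega)]; exact hcut k (3 + n) j
      · have h1 := hcut k (j + (3 + n)) (3 - j)
        rwa [← add_assoc, Nat.sub_add_cancel hj] at h1
  have hcomm : ∀ (R : End ℂ V) (e : ℕ), Commute a R → (∀ k, ∀ v ∈ W k, R v ∈ W (k + e)) →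
      ∀ u ∈ I k (3 + n), R u ∈ I (k + e) (3 + n) := by
    rintro R e haR hR _ ⟨w, hw, rfl⟩
    refine ⟨R w, hR k w hw, ?_⟩
    have := (haR.pow_left (3 + n)).eq
    exact LinearMap.congr_fun this w
  -- On `U`, put `A = a⁻¹ P` and `B = a⁻² Q`. Commutation with `a` is what makes `P` and `Q` respect
  -- images of powers of `a`.
  obtain ⟨A, hA⟩ := exists_lift_of_map_eq (hmap 1 (by omega)) (hinj 1 (by omega))
    (hcomm P 1 haP hP)
  obtain ⟨B, hB⟩ := exists_lift_of_map_eq (hmap 2 (by omega)) (hinj 2 (by omega))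
    (hcomm Q 2 haQ hQ)
  refine hpos (finrank_eq_zero_of_commutator_eq_smul (A := A) (B := B) hc ?_)
  ext u
  -- The identity `[A, B] = c` is checked after applying `a ^ 3`, injective on `U`: there `AB` and
  -- `BA` become `PQ` and `QP`.
  refine sub_eq_zero.mp (hinj3 _ (Submodule.sub_mem _ (Subtype.prop _) (Subtype.prop _)) ?_)
  have h21 : a ^ 3 = a ^ 2 * a ^ 1 := (pow_add a 2 1)
  have h12 : a ^ 3 = a ^ 1 * a ^ 2 := (pow_add a 1 2)
  have e1 : (a ^ 3) ((A (B u) : _) : V) = P (Q u) := by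
    rw [h21, Module.End.mul_apply, hA, ← hB]
    exact LinearMap.congr_fun (haP.pow_left 2).eq _
  have e2 : (a ^ 3) ((B (A u) : _) : V) = Q (P u) := by
    rw [h12, Module.End.mul_apply, hB, ← hA]
    exact LinearMap.congr_fun (haQ.pow_left 1).eq _
  have e3 := LinearMap.congr_fun h (u : V)
  simp only [LinearMap.sub_apply, Module.End.mul_apply, LinearMap.smul_apply] at e3
  simp only [LinearMap.sub_apply, Module.End.mul_apply, LinearMap.smul_apply, Module.End.one_apply,
    Submodule.coe_sub, Submodule.coe_smul, map_sub, map_smul, e1, e2, e3, sub_self]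

end trace

/-- If a ladder of commuting operators is shifted by a derivation and the products of distinct members
are nilpotent, then so is each member. -/
lemma isNilpotent_of_ladder {E : Type*} [Ring E] [Algebra ℂ E] {Z : ℤ → E} {d : E}
    (hZ : ∀ i j, Commute (Z i) (Z j)) (hd : ∀ j, d * Z j - Z j * d = Z (j - 1))
    (hnil : ∀ i j, i ≠ j → IsNilpotent (Z i * Z j)) : IsNilpotent (Z 0) := by
  have hder : ∀ i j, d * (Z i * Z j) - Z i * Z j * d = Z (i - 1) * Z j + Z i * Z (j - 1) := by
    intro i j
    rw [← hd i, ← hd j]; noncomm_ring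
  have hprod : ∀ i j k l, Commute (Z i * Z j) (Z k * Z l) := fun i j k l =>
    ((hZ i k).mul_left (hZ j k)).mul_right ((hZ i l).mul_left (hZ j l))
  -- Commutation with `d` turns the nilpotent `Z 0 * Z 1` into `Z (-1) * Z 1 + Z 0 * Z 0`; the first
  -- summand is again a product of distinct members and can be subtracted.
  have h1 : IsNilpotent (Z (0 - 1) * Z 1 + Z 0 * Z (1 - 1)) := by
    refine isNilpotent_commutator (d := d) (w := Z 0 * Z 1) (hder 0 1).symm rfl
      ((hprod _ _ _ _).add_right (hprod _ _ _ _)) ?_ (hnil 0 1 (by norm_num))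
    have h2 : d * (Z (0 - 1) * Z 1 + Z 0 * Z (1 - 1)) -
        (Z (0 - 1) * Z 1 + Z 0 * Z (1 - 1)) * d =
        (d * (Z (0 - 1) * Z 1) - Z (0 - 1) * Z 1 * d) +
          (d * (Z 0 * Z (1 - 1)) - Z 0 * Z (1 - 1) * d) := by noncomm_ring
    rw [h2, hder, hder]
    refine Commute.add_left ?_ ?_ <;> refine Commute.add_right ?_ ?_ <;>
      exact (hprod _ _ _ _).add_right (hprod _ _ _ _)
  have h2 := Commute.isNilpotent_sub ((hprod _ _ _ _).add_left (hprod _ _ _ _)) h1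
    (hnil (0 - 1) 1 (by norm_num))
  rw [add_sub_cancel_left] at h2
  obtain ⟨n, hn⟩ := h2
  refine ⟨n + n, ?_⟩
  rw [pow_add, ← (Commute.refl _).mul_pow]
  exact hn

/-! ### Weights for the adjoint action of the Cartan subalgebra -/

namespace FullToroidal

variable {𝔤 : Type*} [LieRing 𝔤] [LieAlgebra ℂ 𝔤] {κ : InvariantForm 𝔤} {ν : ℕ} {c₁ c₂ : ℂ}

/-- The functional on `τ` which extends `φ` on `𝔤 ⊗ 1` and takes `d_a` to `n_a`. -/
def weightForm (φ : Module.Dual ℂ 𝔤) (n : Fin (ν + 1) → ℤ) : FullToroidal κ ν c₁ c₂ →ₗ[ℂ] ℂ where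
  toFun X := TensorProduct.lid ℂ ℂ (TensorProduct.map ((monoBasis ν).coord 0) φ X.loop) +
    ∑ a, (n a : ℂ) * (monoBasis ν).coord 0 (coef X.der a)
  map_add' X Y := by
    simp only [loop_add, der_add, map_add, coef_add, mul_add, Finset.sum_add_distrib]
    abel
  map_smul' c X := by
    simp only [loop_smul, der_smul, map_smul, coef_smul, smul_eq_mul, mul_add, Finset.mul_sum,
      RingHom.id_apply]
    congr 1
    exact Finset.sum_congr rfl fun a _ => by ring

variable (φ : Module.Dual ℂ 𝔤) (m n : Fin (ν + 1) → ℤ)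

lemma coord_mono_zero : (monoBasis ν).coord 0 (mono 0) = 1 := by
  rw [← monoBasis_apply]; simp

lemma coef_zero (a : Fin (ν + 1)) : coef (0 : Der ν) a = 0 := by simp [coef]

lemma weightForm_xt (x : 𝔤) : weightForm φ n (xt x 0 : FullToroidal κ ν c₁ c₂) = φ x := by
  simp [weightForm, xt, ofLoop, coef_zero, coord_mono_zero, -Module.Basis.coord_apply]

lemma weightForm_tk (p : Fin (ν + 1)) :
    weightForm φ n (tk m p : FullToroidal κ ν c₁ c₂) = 0 := by
  simp [weightForm, tk, ofKer, coef_zero]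

lemma weightForm_td (a : Fin (ν + 1)) :
    weightForm φ n (td 0 a : FullToroidal κ ν c₁ c₂) = n a := by
  have h : ∀ b, (monoBasis ν).coord 0 (coef ((mono 0 : Laurent ν) • deg a) b) =
      if a = b then 1 else 0 := by
    intro b
    rw [coef_smul_deg]
    split_ifs
    · exact coord_mono_zero
    · simp
  simp only [weightForm, td, ofDer, LinearMap.coe_mk, AddHom.coe_mk, h]
  simp

/-- The weight of `𝔥` which is `φ` on `𝔥̇` and takes `d_a` to `n_a`. -/
def cartanWeight (H : LieSubalgebra ℂ 𝔤) : Module.Dual ℂ (cartan κ ν c₁ c₂ H) :=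
  (weightForm φ n).domRestrict _

variable {φ m n}

lemma cartanWeight_add (H : LieSubalgebra ℂ 𝔤) : (cartanWeight 0 (m + n) H :
    Module.Dual ℂ (cartan κ ν c₁ c₂ H)) = cartanWeight 0 m H + cartanWeight 0 n H := by
  ext X
  simp [cartanWeight, weightForm, add_mul, Finset.sum_add_distrib]

lemma cartanWeight_zero (H : LieSubalgebra ℂ 𝔤) : (cartanWeight 0 0 H :
    Module.Dual ℂ (cartan κ ν c₁ c₂ H)) = 0 := by
  ext X
  simp [cartanWeight, weightForm]

/-- The target does not depend on `n`: this is why one weight space can bound the dimensions for all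
degrees. -/
lemma cartanWeight_add_neg (H : LieSubalgebra ℂ 𝔤) : (cartanWeight 0 n H + cartanWeight φ (-n) H :
    Module.Dual ℂ (cartan κ ν c₁ c₂ H)) = cartanWeight φ 0 H := by
  ext X
  simp [cartanWeight, weightForm]

/-- `X` is a weight vector of weight `(φ, n)` for the adjoint action of `𝔥`. -/
def IsWeightVector (H : LieSubalgebra ℂ 𝔤) (φ : Module.Dual ℂ 𝔤) (n : Fin (ν + 1) → ℤ)
    (X : FullToroidal κ ν c₁ c₂) : Prop :=
  ∀ h ∈ cartan κ ν c₁ c₂ H, ⁅h, X⁆ = weightForm φ n h • X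

/-- Both sides of the weight condition are linear in `h`, so it can be tested on the three spanning
families of `𝔥`. -/
lemma isWeightVector_of {H : LieSubalgebra ℂ 𝔤} {X : FullToroidal κ ν c₁ c₂}
    (h1 : ∀ h ∈ H, ⁅(xt h 0 : FullToroidal κ ν c₁ c₂), X⁆ = φ h • X)
    (h2 : ∀ p, ⁅(tk 0 p : FullToroidal κ ν c₁ c₂), X⁆ = 0)
    (h3 : ∀ a, ⁅(td 0 a : FullToroidal κ ν c₁ c₂), X⁆ = (n a : ℂ) • X) :
    IsWeightVector H φ n X := by
  let F : FullToroidal κ ν c₁ c₂ →ₗ[ℂ] FullToroidal κ ν c₁ c₂ :=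
    { toFun := fun h => ⁅h, X⁆ - weightForm φ n h • X
      map_add' := fun h h' => by rw [add_lie, map_add, add_smul]; abel
      map_smul' := fun c h => by
        rw [smul_lie, map_smul, smul_eq_mul, mul_smul, RingHom.id_apply, smul_sub] }
  have hF : cartan κ ν c₁ c₂ H ≤ LinearMap.ker F := by
    refine sup_le (Submodule.span_le.mpr ?_)
      (sup_le (Submodule.span_le.mpr ?_) (Submodule.span_le.mpr ?_))
    · rintro _ ⟨h, hh, rfl⟩
      change _ - _ = (0 : FullToroidal κ ν c₁ c₂)
      rw [weightForm_xt, h1 h hh, sub_self]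
    · rintro _ ⟨p, rfl⟩
      change _ - _ = (0 : FullToroidal κ ν c₁ c₂)
      rw [weightForm_tk, h2 p, zero_smul, sub_self]
    · rintro _ ⟨a, rfl⟩
      change _ - _ = (0 : FullToroidal κ ν c₁ c₂)
      rw [weightForm_td, h3 a, sub_self]
  intro h hh
  exact sub_eq_zero.mp (hF hh)

lemma lie_tk_xt (x : 𝔤) (p : Fin (ν + 1)) :
    ⁅(tk m p : FullToroidal κ ν c₁ c₂), (xt x n : FullToroidal κ ν c₁ c₂)⁆ = 0 := by
  rw [← lie_skew, lie_xt_tk, neg_zero]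

/-- The defining relation `∑ m_r t^m k_r = 0` removes the only term that could survive. -/
lemma lie_tk_zero_td (a p : Fin (ν + 1)) :
    ⁅(tk 0 p : FullToroidal κ ν c₁ c₂), (td m a : FullToroidal κ ν c₁ c₂)⁆ = 0 := by
  rw [← lie_skew, lie_td_tk, add_zero, sum_tk]
  simp

lemma isWeightVector_tk (H : LieSubalgebra ℂ 𝔤) (p : Fin (ν + 1)) :
    IsWeightVector H 0 m (tk m p : FullToroidal κ ν c₁ c₂) := by
  refine isWeightVector_of (fun h _ => ?_) (fun q => lie_tk_tk _ _ _ _) fun a => ?_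
  · rw [lie_xt_tk]; simp
  · rw [lie_td_tk, zero_add]; simp

lemma isWeightVector_td (H : LieSubalgebra ℂ 𝔤) (a : Fin (ν + 1)) :
    IsWeightVector H 0 m (td m a : FullToroidal κ ν c₁ c₂) := by
  refine isWeightVector_of (fun h _ => ?_) (fun q => lie_tk_zero_td _ _) fun b => ?_
  · rw [← lie_skew, lie_td_xt]; simp
  · rw [lie_td_td, zero_add]; simp

lemma isWeightVector_xt {H : LieSubalgebra ℂ 𝔤} {x : 𝔤} (hx : ∀ h ∈ H, ⁅h, x⁆ = φ h • x) :
    IsWeightVector H φ m (xt x m : FullToroidal κ ν c₁ c₂) := by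
  refine isWeightVector_of (fun h hh => ?_) (fun q => lie_tk_xt _ _) fun b => ?_
  · rw [lie_xt_xt, hx h hh, zero_add]; simp [xt]
  · rw [lie_td_xt, zero_add]

lemma lie_ofLoop_tk (f : Laurent ν) (x : 𝔤) (p : Fin (ν + 1)) :
    ⁅(ofLoop (f ⊗ₜ[ℂ] x) : FullToroidal κ ν c₁ c₂), (tk m p : FullToroidal κ ν c₁ c₂)⁆ = 0 := by
  have h : actLoop (0 : Der ν) = (0 : MultiLoop ν 𝔤 →ₗ[ℂ] MultiLoop ν 𝔤) := by
    ext; simp [actLoop]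
  have h0 : ∀ w : Ker ν, actK (0 : Der ν) w = 0 := fun w => by
    have := actK_smul 0 (0 : Der ν) w
    simpa using this
  ext1
  · simp [loop_lie, tk, ofLoop, ofKer, h]
  · simp [cen_lie, tk, ofLoop, ofKer, h0, cocycle, cocycle₁, cocycle₂, mpair, jac, dvg, coef]
  · simp [der_lie, tk, ofLoop, ofKer]

lemma lie_ofLoop_td (f : Laurent ν) (x : 𝔤) (a : Fin (ν + 1)) :
    ⁅(ofLoop (f ⊗ₜ[ℂ] x) : FullToroidal κ ν c₁ c₂), (td m a : FullToroidal κ ν c₁ c₂)⁆ =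
      ofLoop ((-(mono m * deg a f)) ⊗ₜ[ℂ] x) := by
  ext1
  · simp [loop_lie, td, ofLoop, ofDer, actLoop_tmul, TensorProduct.neg_tmul]
  · simp [cen_lie, td, ofLoop, ofDer, cocycle, cocycle₁, cocycle₂, mpair, jac, dvg, coef]
  · simp [der_lie, td, ofLoop, ofDer]

/-- Orthogonality of `x` and `y` removes the `𝒦`-component, so the bracket stays inside the loop
algebra. -/
lemma lie_ofLoop_xt (f : Laurent ν) {x y : 𝔤} (h : κ.form x y = 0) :
    ⁅(ofLoop (f ⊗ₜ[ℂ] x) : FullToroidal κ ν c₁ c₂), (xt y m : FullToroidal κ ν c₁ c₂)⁆ =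
      ofLoop ((f * mono m) ⊗ₜ[ℂ] ⁅x, y⁆) := by
  have h' : actLoop (0 : Der ν) = (0 : MultiLoop ν 𝔤 →ₗ[ℂ] MultiLoop ν 𝔤) := by
    ext; simp [actLoop]
  ext1
  · simp [loop_lie, xt, ofLoop, h']
  · simp [cen_lie, xt, ofLoop, cocycle, cocycle₁, cocycle₂, mpair, jac, dvg, coef,
      loopCocycle_tmul, h]
  · simp [der_lie, xt, ofLoop]

end FullToroidal

open FullToroidal

/-! ### Operators on a module, and vectors killed by the centre part `𝒦 ⊗ B` -/

section operators

variable {𝔤 : Type*} [LieRing 𝔤] [LieAlgebra ℂ 𝔤] {κ : InvariantForm 𝔤} {ν : ℕ} {c₁ c₂ : ℂ}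
  {B : Type*} [CommRing B] [Algebra ℂ B] {H : LieSubalgebra ℂ 𝔤}
  {V : Type*} [AddCommGroup V] [Module ℂ V] [LieRingModule (MapFullToroidal κ ν c₁ c₂ B) V]
  [LieModule ℂ (MapFullToroidal κ ν c₁ c₂ B) V]

lemma map_lie_tmul (b b' : B) (X Y : FullToroidal κ ν c₁ c₂) :
    ⁅(b ⊗ₜ[ℂ] X : MapFullToroidal κ ν c₁ c₂ B), (b' ⊗ₜ[ℂ] Y : MapFullToroidal κ ν c₁ c₂ B)⁆ =
      (b * b') ⊗ₜ[ℂ] ⁅X, Y⁆ :=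
  LieAlgebra.ExtendScalars.bracket_tmul _ _ _ _ _ _ _ _

lemma lie_tmul_smul (b : B) (c : ℂ) (X : FullToroidal κ ν c₁ c₂) (v : V) :
    ⁅(b ⊗ₜ[ℂ] (c • X) : MapFullToroidal κ ν c₁ c₂ B), v⁆ =
      c • ⁅(b ⊗ₜ[ℂ] X : MapFullToroidal κ ν c₁ c₂ B), v⁆ := by
  rw [TensorProduct.tmul_smul]
  exact smul_lie _ _ _

lemma lie_mem_weightSpace {φ : Module.Dual ℂ 𝔤} {n : Fin (ν + 1) → ℤ}
    {X : FullToroidal κ ν c₁ c₂} (hX : IsWeightVector H φ n X) (b : B)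
    {χ : Module.Dual ℂ (cartan κ ν c₁ c₂ H)} {v : V} (hv : v ∈ weightSpace κ ν c₁ c₂ B H V χ) :
    ⁅(b ⊗ₜ[ℂ] X : MapFullToroidal κ ν c₁ c₂ B), v⁆ ∈
      weightSpace κ ν c₁ c₂ B H V (χ + cartanWeight φ n H) := by
  intro h
  have hψ : cartanWeight φ n H h = weightForm φ n (h : FullToroidal κ ν c₁ c₂) := rfl
  rw [leibniz_lie, map_lie_tmul, one_mul, hX h h.2, hv h, lie_smul, lie_tmul_smul,
    LinearMap.add_apply, add_smul, hψ, add_comm]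

variable (V) in
/-- The operator on a `τ(B)`-module given by `X ⊗ b`, as a linear function of `X ∈ τ`. -/
def op (b : B) : FullToroidal κ ν c₁ c₂ →ₗ[ℂ] Module.End ℂ V :=
  (LieModule.toEnd ℂ (MapFullToroidal κ ν c₁ c₂ B) V : _ →ₗ[ℂ] _) ∘ₗ
    TensorProduct.mk ℂ B (FullToroidal κ ν c₁ c₂) b

lemma op_apply (b : B) (X : FullToroidal κ ν c₁ c₂) (v : V) :
    op V b X v = ⁅(b ⊗ₜ[ℂ] X : MapFullToroidal κ ν c₁ c₂ B), v⁆ := rfl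

lemma op_commutator (b b' : B) (X Y : FullToroidal κ ν c₁ c₂) :
    op V b X * op V b' Y - op V b' Y * op V b X = op V (b * b') ⁅X, Y⁆ := by
  ext v
  simp only [LinearMap.sub_apply, Module.End.mul_apply, op_apply]
  rw [← map_lie_tmul, lie_lie]

lemma op_commute {X Y : FullToroidal κ ν c₁ c₂} (h : ⁅X, Y⁆ = 0) (b b' : B) :
    Commute (op V b X) (op V b' Y) := by
  rw [Commute, SemiconjBy, ← sub_eq_zero, op_commutator, h, map_zero]

lemma op_tk_commute (m n : Fin (ν + 1) → ℤ) (p q : Fin (ν + 1)) (b b' : B) :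
    Commute (op V b (tk m p : FullToroidal κ ν c₁ c₂)) (op V b' (tk n q : FullToroidal κ ν c₁ c₂)) :=
  op_commute (lie_tk_tk _ _ _ _) _ _

lemma op_sum_tk_zero (hzero : ZeroCentralCharge κ ν c₁ c₂ B V) (r : Fin (ν + 1) → ℂ) :
    op V (1 : B) (∑ p, r p • tk 0 p : FullToroidal κ ν c₁ c₂) = 0 := by
  rw [map_sum]
  refine Finset.sum_eq_zero fun p _ => ?_
  rw [map_smul]
  ext v
  rw [LinearMap.smul_apply, op_apply, hzero p v, smul_zero, LinearMap.zero_apply]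

/-- `𝒦` is an abelian ideal on which only the derivation component acts; this underlies both the
invariance of its annihilator and the commutation of `z` with `[d, z]`. -/
lemma lie_ofKer (w : Ker ν) (X : FullToroidal κ ν c₁ c₂) :
    ⁅(ofKer w : FullToroidal κ ν c₁ c₂), X⁆ = ofKer (-actK X.der w) := by
  have h : actLoop (0 : Der ν) = (0 : MultiLoop ν 𝔤 →ₗ[ℂ] MultiLoop ν 𝔤) := by
    ext; simp [actLoop]
  have h0 : ∀ w : Ker ν, actK (0 : Der ν) w = 0 := fun w => by
    have := actK_smul 0 (0 : Der ν) w
    simpa using this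
  ext1
  · simp [loop_lie, ofKer, h]
  · simp [cen_lie, ofKer, h0, cocycle, cocycle₁, cocycle₂, mpair, jac, dvg, coef]
  · simp [der_lie, ofKer]

lemma op_ofKer_eq_zero {v : V} (b : B)
    (h : ∀ m p, op V b (tk m p : FullToroidal κ ν c₁ c₂) v = 0) (w : Ker ν) :
    op V b (ofKer w : FullToroidal κ ν c₁ c₂) v = 0 := by
  let F : Ker ν →ₗ[ℂ] V := (op V b : FullToroidal κ ν c₁ c₂ →ₗ[ℂ] _).flip v ∘ₗ ofKer
  have hF : F = 0 := by
    refine Submodule.linearMap_qext _ (LinearMap.pi_ext' fun p => laurent_hom_ext fun m => ?_)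
    exact h m p
  exact LinearMap.congr_fun hF w

/-- In an irreducible `τ(B)`-module, `𝒦 ⊗ B` acts by zero as soon as it kills a nonzero vector. -/
lemma op_tk_eq_zero_of_irreducible
    (hirr : LieModule.IsIrreducible ℂ (MapFullToroidal κ ν c₁ c₂ B) V) {v : V} (hv0 : v ≠ 0)
    (hv : ∀ (b : B) m p, op V b (tk m p : FullToroidal κ ν c₁ c₂) v = 0) (b : B)
    (m : Fin (ν + 1) → ℤ) (p : Fin (ν + 1)) (u : V) :
    op V b (tk m p : FullToroidal κ ν c₁ c₂) u = 0 := by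
  -- The annihilator of `𝒦 ⊗ B` is a submodule because `𝒦 ⊗ B` is an ideal.
  let N : LieSubmodule ℂ (MapFullToroidal κ ν c₁ c₂ B) V :=
    { carrier := {u | ∀ (b : B) (w : Ker ν), op V b (ofKer w : FullToroidal κ ν c₁ c₂) u = 0}
      zero_mem' := fun b w => map_zero _
      add_mem' := fun {u u'} hu hu' b w => by rw [map_add, hu b w, hu' b w, add_zero]
      smul_mem' := fun c u hu b w => by rw [map_smul, hu b w, smul_zero]
      lie_mem := by
        intro X u hu b w
        induction X using TensorProduct.induction_on with
        | zero => rw [zero_lie, map_zero]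
        | add X Y hX hY => rw [add_lie, map_add, hX, hY, add_zero]
        | tmul b' X =>
          have h := LinearMap.congr_fun
            (op_commutator (V := V) b b' (ofKer w : FullToroidal κ ν c₁ c₂) X) u
          rw [lie_ofKer, hu, LinearMap.sub_apply, Module.End.mul_apply, Module.End.mul_apply, hu,
            map_zero, sub_zero] at h
          exact h }
  have hN : N ≠ ⊥ := fun h => hv0 <| by
    have : v ∈ N := fun b w => op_ofKer_eq_zero b (hv b) w
    rwa [h, LieSubmodule.mem_bot] at this
  have hu : u ∈ N := by
    rw [(eq_bot_or_eq_top N).resolve_left hN]; trivial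
  exact hu b _

/-- A power of `t_a k_q` sends vectors killed by all `t^s k_p ⊗ b`, `p ∈ S`, to vectors which are
moreover killed by all `t^s k_q ⊗ b` and `t^s k_a ⊗ b`. -/
lemma exists_killed_insert {M : Submodule ℂ V} {S : Set (Fin (ν + 1))} {a q : Fin (ν + 1)}
    (haq : a ≠ q) (haS : a ∉ S) (hqS : q ∉ S)
    (hMk : ∀ (b : B) m p, ∀ v ∈ M, op V b (tk m p : FullToroidal κ ν c₁ c₂) v ∈ M)
    (hMd : ∀ (b : B) m p, ∀ v ∈ M, op V b (td m p : FullToroidal κ ν c₁ c₂) v ∈ M)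
    (hnil : ∃ E : ℕ, ∀ v ∈ M,
      (op V (1 : B) (tk (Pi.single a 1) q : FullToroidal κ ν c₁ c₂) ^ E) v = 0)
    (hS : ∃ v ∈ M, v ≠ 0 ∧ ∀ p ∈ S, ∀ (b : B) s,
      op V b (tk s p : FullToroidal κ ν c₁ c₂) v = 0) :
    ∃ v ∈ M, v ≠ 0 ∧ ∀ p, p ∈ S ∨ p = q ∨ p = a → ∀ (b : B) s,
      op V b (tk s p : FullToroidal κ ν c₁ c₂) v = 0 := by
  classical
  set z := op V (1 : B) (tk (Pi.single a 1) q : FullToroidal κ ν c₁ c₂) with hz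
  let N : Set V := {v | v ∈ M ∧ ∀ p ∈ S, ∀ (b : B) s,
      op V b (tk s p : FullToroidal κ ν c₁ c₂) v = 0}
  -- The exponent `L` is taken minimal for the whole set `N`, not for one vector, so that `z ^ L`
  -- also kills `d v` whenever `d` preserves `N`.
  have hex : ∃ L : ℕ, ∀ v ∈ N, (z ^ L) v = 0 := by
    obtain ⟨E, hE⟩ := hnil
    exact ⟨E, fun v hv => hE v hv.1⟩
  have hL := Nat.find_spec hex
  have hmin := fun {m} => Nat.find_min hex (m := m)
  set L := Nat.find hex
  obtain ⟨L', hL'⟩ : ∃ L', L = L' + 1 := by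
    refine Nat.exists_eq_succ_of_ne_zero fun h0 => ?_
    obtain ⟨v, hvM, hv0, hvS⟩ := hS
    refine hv0 ?_
    have := hL v ⟨hvM, hvS⟩
    rwa [h0, pow_zero] at this
  have h1 := hmin (m := L') (by omega)
  push Not at h1
  obtain ⟨v, hvN, hv0⟩ := h1
  rw [hL'] at hL
  have hpow : ∀ n : ℕ, (z ^ n) v ∈ M := by
    intro n
    induction n with
    | zero => exact hvN.1
    | succ n ih => rw [pow_succ', Module.End.mul_apply]; exact hMk _ _ _ _ ih
  -- For `a' ∉ S`, the operator `d = t^m d_{a'} ⊗ b` preserves `N`, since the `δ`-term in its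
  -- bracket with `t^s k_p`, `p ∈ S`, is absent. Expanding `[d, z ^ (L' + 1)] v = 0` then gives `[d,
  -- z] z ^ L' v = 0`.
  have hder : ∀ (b : B) m a', a' ∉ S →
      op V b ⁅(td m a' : FullToroidal κ ν c₁ c₂), (tk (Pi.single a 1) q : FullToroidal κ ν c₁ c₂)⁆ ((z ^ L') v) = 0 := by
    intro b m a' ha'
    set d := op V b (td m a' : FullToroidal κ ν c₁ c₂) with hd
    have hdv : d v ∈ N := by
      refine ⟨hMd _ _ _ _ hvN.1, fun p hp b' s => ?_⟩
      have h := LinearMap.congr_fun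
        (op_commutator (V := V) b b' (td m a' : FullToroidal κ ν c₁ c₂) (tk s p : FullToroidal κ ν c₁ c₂)) v
      have hne : a' ≠ p := fun h => ha' (h ▸ hp)
      rw [lie_td_tk, if_neg hne, add_zero, map_smul, LinearMap.smul_apply, hvN.2 p hp,
        LinearMap.sub_apply, Module.End.mul_apply, Module.End.mul_apply, hvN.2 p hp, map_zero,
        smul_zero, zero_sub, neg_eq_zero] at h
      exact h
    have hdz : d * z - z * d = op V b ⁅(td m a' : FullToroidal κ ν c₁ c₂), (tk (Pi.single a 1) q : FullToroidal κ ν c₁ c₂)⁆ := by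
      rw [hd, hz, op_commutator, mul_one]
    have hcomm : Commute z (d * z - z * d) := by
      rw [hdz, ← neg_neg ⁅(td m a' : FullToroidal κ ν c₁ c₂), _⁆, lie_skew, tk, lie_ofKer, hz]
      refine op_commute ?_ _ _
      rw [tk, ← map_neg, lie_ofKer]
      simp only [ofKer, LinearMap.coe_mk, AddHom.coe_mk]
      have : actK (0 : Der ν) (kEl q (mono (Pi.single a 1))) = 0 := by
        have := actK_smul 0 (0 : Der ν) (kEl q (mono (Pi.single a 1)))
        simpa using this
      rw [this, neg_zero]; rfl
    have h := LinearMap.congr_fun (commutator_pow hcomm (L' + 1)) v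
    rw [Nat.add_sub_cancel, LinearMap.sub_apply, Module.End.mul_apply, Module.End.mul_apply,
      hL v hvN, hL _ hdv, map_zero, sub_zero, (hcomm.pow_left L').eq, hdz, ← nsmul_eq_mul,
      LinearMap.smul_apply, Module.End.mul_apply, ← Nat.cast_smul_eq_nsmul ℂ] at h
    exact (smul_eq_zero.mp h.symm).resolve_left (Nat.cast_ne_zero.mpr L'.succ_ne_zero)
  refine ⟨(z ^ L') v, hpow _, hv0, ?_⟩
  rintro p (hp | rfl | rfl) b s
  · have h := LinearMap.congr_fun
      ((op_tk_commute (V := V) (κ := κ) (c₁ := c₁) (c₂ := c₂) s (Pi.single a 1) p q b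
        (1 : B)).pow_right L').eq v
    rw [Module.End.mul_apply, Module.End.mul_apply, hvN.2 p hp, map_zero] at h
    exact h
  -- `[t^s t_a⁻¹ d_a, t_a k_q] = t^s k_q`, as `a ≠ q`.
  · have h := hder b (s - Pi.single a 1) a haS
    rw [lie_td_tk, if_neg haq, add_zero, sub_add_cancel, Pi.single_eq_same, Int.cast_one,
      one_smul] at h
    exact h
  -- With `d_q` only the `δ`-term survives, and `∑ s_r t^s k_r = 0` reduces it to `-t^s k_a`.
  · have h := hder b (s - Pi.single p 1) q hqS
    have hsum : ∑ r, ((s - Pi.single p 1 : Fin (ν + 1) → ℤ) r : ℂ) •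
        (tk s r : FullToroidal κ ν c₁ c₂) = - tk s p := by
      simp only [Pi.sub_apply, Int.cast_sub, sub_smul, Finset.sum_sub_distrib, sum_tk, zero_sub]
      rw [Finset.sum_eq_single p]
      · simp
      · intro r _ hr; simp [hr]
      · simp
    rw [lie_td_tk, if_pos rfl, sub_add_cancel, Pi.single_eq_of_ne haq.symm, Int.cast_zero,
      zero_smul, zero_add, hsum, map_neg, LinearMap.neg_apply, neg_eq_zero] at h
    exact h

/-- If each `t_a k_q ⊗ 1` is nilpotent on a nonzero subspace which is stable under `𝒦 ⊗ B` and
`𝒟 ⊗ B`, then `𝒦 ⊗ B` kills a nonzero vector. -/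
lemma exists_killed (hν : 1 ≤ ν) {M : Submodule ℂ V} (hM : M ≠ ⊥)
    (hMk : ∀ (b : B) m p, ∀ v ∈ M, op V b (tk m p : FullToroidal κ ν c₁ c₂) v ∈ M)
    (hMd : ∀ (b : B) m p, ∀ v ∈ M, op V b (td m p : FullToroidal κ ν c₁ c₂) v ∈ M)
    (hnil : ∀ a q, a ≠ q → ∃ E : ℕ, ∀ v ∈ M,
      (op V (1 : B) (tk (Pi.single a 1) q : FullToroidal κ ν c₁ c₂) ^ E) v = 0) :
    ∃ v : V, v ≠ 0 ∧ ∀ (b : B) m p, op V b (tk m p : FullToroidal κ ν c₁ c₂) v = 0 := by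
  obtain ⟨a, q, haq⟩ : ∃ a q : Fin (ν + 1), a ≠ q := by
    have : Nontrivial (Fin (ν + 1)) := Fin.nontrivial_iff_two_le.mpr (by omega)
    exact exists_pair_ne _
  -- The index `a` serves every insertion and must stay outside `S`, so the vanishing of `t^s k_a`
  -- gained at each round is discarded; the final round, with the pair `a, q`, recovers it.
  have key : ∀ S : Finset (Fin (ν + 1)), a ∉ S → q ∉ S → ∃ v ∈ M, v ≠ 0 ∧ ∀ p ∈ (S : Set _),
      ∀ (b : B) s, op V b (tk s p : FullToroidal κ ν c₁ c₂) v = 0 := by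
    intro S
    induction S using Finset.induction_on with
    | empty =>
      intro _ _
      obtain ⟨v, hv, hv0⟩ := Submodule.exists_mem_ne_zero_of_ne_bot hM
      exact ⟨v, hv, hv0, by simp⟩
    | insert r S hr ih =>
      intro ha hq
      simp only [Finset.mem_insert, not_or] at ha hq
      obtain ⟨v, hv, hv0, h⟩ := exists_killed_insert (S := (S : Set _)) ha.1 (by simpa using ha.2)
        (by simpa using hr) hMk hMd (hnil a r ha.1) (ih ha.2 hq.2)
      refine ⟨v, hv, hv0, fun p hp => h p ?_⟩
      rcases Finset.mem_insert.mp (Finset.mem_coe.mp hp) with rfl | hp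
      · exact Or.inr (Or.inl rfl)
      · exact Or.inl hp
  classical
  obtain ⟨v, -, hv0, h⟩ := exists_killed_insert
    (S := ((Finset.univ.erase a).erase q : Finset (Fin (ν + 1)))) haq
    (by simp) (by simp) hMk hMd (hnil a q haq) (key _ (by simp) (by simp))
  refine ⟨v, hv0, fun b m p => h p ?_ b m⟩
  by_cases hp : p = q
  · exact Or.inr (Or.inl hp)
  · by_cases hp' : p = a
    · exact Or.inr (Or.inr hp')
    · left; simp [hp, hp']

end operators

open LieAlgebra LieAlgebra.IsKilling

/-- The padding `z ^ 2`, `z' ^ 3` makes the commutator a power of `z z'` and, for the Heisenberg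
pair used below, gives the two factors once and twice the degree of `z z'`. -/
lemma mul_commutator_eq_pow {E : Type*} [Ring E] [Algebra ℂ E] {X Y z z' : E} {c : ℂ}
    (h : X * Y - Y * X = c • z) (hzY : Commute z Y) (hX : Commute z' X)
    (hz : Commute z z') :
    (X * z ^ 2) * (Y * z' ^ 3) - (Y * z' ^ 3) * (X * z ^ 2) = c • (z * z') ^ 3 := by
  have h1 : (X * z ^ 2) * (Y * z' ^ 3) = X * Y * (z ^ 2 * z' ^ 3) := by
    rw [mul_assoc, ← mul_assoc (z ^ 2), (hzY.pow_left 2).eq]; simp only [mul_assoc]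
  have h2 : (Y * z' ^ 3) * (X * z ^ 2) = Y * X * (z ^ 2 * z' ^ 3) := by
    rw [mul_assoc, ← mul_assoc (z' ^ 3), (hX.pow_left 3).eq, mul_assoc X,
      ((hz.pow_left 2).pow_right 3).eq]
    simp only [mul_assoc]
  rw [h1, h2, ← sub_mul, h, smul_mul_assoc, ← mul_assoc, ← pow_succ', hz.mul_pow]

/-! ### Coroots, the invariant form and the positive part of the finite-dimensional algebra -/

variable {𝔤 : Type*} [LieRing 𝔤] [LieAlgebra ℂ 𝔤] [FiniteDimensional ℂ 𝔤]
  [LieAlgebra.IsSimple ℂ 𝔤] {H : LieSubalgebra ℂ 𝔤} [H.IsCartanSubalgebra]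
  {Δ : (LieAlgebra.IsKilling.rootSystem H).Base}

lemma lie_eq_smul_of_mem {α : LieModule.Weight ℂ H 𝔤} {x : 𝔤} (hx : x ∈ rootSpace H α) {h : 𝔤}
    (hh : h ∈ H) : ⁅h, x⁆ = α ⟨h, hh⟩ • x :=
  lie_eq_smul_of_mem_rootSpace hx ⟨h, hh⟩

lemma lie_eq_zero_of_mem_cartan {h h' : 𝔤} (hh : h ∈ H) (hh' : h' ∈ H) : ⁅h, h'⁆ = 0 := by
  have : ⁅(⟨h, hh⟩ : H), (⟨h', hh'⟩ : H)⁆ = 0 := trivial_lie_zero _ _ _ _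
  exact congrArg Subtype.val this

/-- The coroots span `H`, and each is, up to sign, the coroot of a positive root. -/
lemma exists_isPos_coroot_ne_zero (Δ : (LieAlgebra.IsKilling.rootSystem H).Base)
    {l : Module.Dual ℂ H} (hl : l ≠ 0) : ∃ α : H.root, Δ.IsPos α ∧ l (coroot α.1) ≠ 0 := by
  by_contra! hne
  apply hl
  have hall : ∀ α : H.root, l ((rootSystem H).coroot α) = 0 := by
    intro α
    rcases RootPairing.Base.IsPos.or_neg Δ α with h | h
    · exact hne α h
    · have h1 := hne _ h
      rw [← rootSystem_coroot_apply] at h1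
      -- The index `-α` is by definition the reflection of `α` in itself.
      change l ((rootSystem H).coroot ((rootSystem H).reflectionPerm α α)) = 0 at h1
      rwa [RootPairing.coroot_reflectionPerm, RootPairing.coreflection_apply_self, map_neg,
        neg_eq_zero] at h1
  have hspan := RootPairing.IsRootSystem.span_coroot_eq_top (P := rootSystem H)
  have : Submodule.span ℂ (Set.range (rootSystem H).coroot) ≤ LinearMap.ker l := by
    rw [Submodule.span_le]
    rintro _ ⟨α, rfl⟩
    exact hall α
  rw [hspan, top_le_iff] at this
  exact LinearMap.ker_eq_top.mp this

/-- Invariance gives `α(h') (x|h) = ([h', x]|h) = -(x|[h', h]) = 0`; choose `h'` with `α(h') ≠ 0`.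
-/
lemma form_rootSpace_eq_zero (κ : InvariantForm 𝔤) {α : LieModule.Weight ℂ H 𝔤} (hα : α.IsNonZero)
    {x h : 𝔤} (hx : x ∈ rootSpace H α) (hh : h ∈ H) : κ.form x h = 0 := by
  obtain ⟨h', hh'⟩ : ∃ h' : H, α h' ≠ 0 := by
    by_contra! h0
    exact hα (funext h0)
  have h1 : κ.form ⁅(h' : 𝔤), x⁆ h = 0 := by
    rw [← lie_skew, map_neg, LinearMap.neg_apply, κ.invariant,
      lie_eq_zero_of_mem_cartan h'.2 hh, map_zero, neg_zero]
  rw [lie_eq_smul_of_mem hx h'.2, map_smul, LinearMap.smul_apply, smul_eq_mul] at h1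
  exact (mul_eq_zero.mp h1).resolve_left hh'

/-- The form `(·|·)` does not vanish on `𝔥̇`. -/
lemma exists_form_ne_zero (κ : InvariantForm 𝔤) {x : 𝔤} (hx : x ∈ H) (hx0 : x ≠ 0) :
    ∃ y ∈ H, κ.form x y ≠ 0 := by
  by_contra! hne
  apply hx0
  apply κ.nondegenerate.1
  -- By the root space decomposition, a vector of `H` orthogonal to `H` is orthogonal to all of `𝔤`,
  -- since `H` is orthogonal to every nonzero root space.
  have htop : ∀ y, y ∈ (⨆ χ : LieModule.Weight ℂ H 𝔤, LieModule.genWeightSpace 𝔤 χ :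
      LieSubmodule ℂ H 𝔤) := by
    rw [LieModule.iSup_genWeightSpace_eq_top']; exact fun y => trivial
  intro y
  induction htop y using LieSubmodule.iSup_induction' with
  | mem χ y hy =>
    by_cases hχ : χ.IsZero
    · have hy' : y ∈ rootSpace H (0 : H → ℂ) := by
        have : (χ : H → ℂ) = 0 := hχ
        rwa [this] at hy
      rw [LieAlgebra.rootSpace_zero_eq] at hy'
      exact hne y hy'
    · rw [κ.symm]; exact form_rootSpace_eq_zero κ hχ hy hx
  | zero => rw [map_zero]
  | add y y' _ _ hy hy' => rw [map_add, hy, hy', add_zero]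

lemma posPart_induction {p : 𝔤 → Prop} {x : 𝔤} (hx : x ∈ posPart Δ)
    (hmem : ∀ α : H.root, Δ.IsPos α → ∀ y ∈ rootSpace H α.1, p y) (h0 : p 0)
    (hadd : ∀ y z, p y → p z → p (y + z)) : p x :=
  Submodule.iSup_induction _ (motive := p) hx (fun α y hy => hmem α.1 α.2 y hy) h0 hadd

lemma rootSpace_le_posPart {α : H.root} (hα : Δ.IsPos α) {x : 𝔤} (hx : x ∈ rootSpace H α.1) :
    x ∈ posPart Δ :=
  Submodule.mem_iSup_of_mem (⟨α, hα⟩ : {α : H.root // Δ.IsPos α}) hx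

lemma lie_mem_posPart {x h : 𝔤} (hx : x ∈ posPart Δ) (hh : h ∈ H) : ⁅x, h⁆ ∈ posPart Δ := by
  refine posPart_induction (p := fun x => ⁅x, h⁆ ∈ posPart Δ) hx (fun α hα y hy => ?_) (by simp) (fun y z hy hz => ?_)
  · rw [← lie_skew, lie_eq_smul_of_mem hy hh]
    exact Submodule.neg_mem _ (Submodule.smul_mem _ _ (rootSpace_le_posPart hα hy))
  · rw [add_lie]; exact Submodule.add_mem _ hy hz

lemma form_posPart_eq_zero (κ : InvariantForm 𝔤) {x h : 𝔤} (hx : x ∈ posPart Δ) (hh : h ∈ H) :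
    κ.form x h = 0 := by
  refine posPart_induction (p := fun x => κ.form x h = 0) hx (fun α hα y hy => ?_) (by simp) (fun y z hy hz => ?_)
  · exact form_rootSpace_eq_zero κ (Finset.mem_filter.mp α.2).2 hy hh
  · rw [map_add, LinearMap.add_apply, hy, hz, add_zero]

/-! ### The top space: bounded weight spaces and nilpotency -/

section graded

variable {κ : InvariantForm 𝔤} {ν : ℕ} {c₁ c₂ : ℂ} {B : Type*} [CommRing B] [Algebra ℂ B]
  {V : Type*} [AddCommGroup V] [Module ℂ V] [LieRingModule (MapFullToroidal κ ν c₁ c₂ B) V]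
  [LieModule ℂ (MapFullToroidal κ ν c₁ c₂ B) V]
  {Λ : Module.Dual ℂ (cartan κ ν c₁ c₂ H)} {m n : Fin (ν + 1) → ℤ}

variable (Δ B V Λ n) in
/-- The part of weight `Λ + ∑ nₐ δₐ` of the top space. -/
def topWeightSpace : Submodule ℂ V :=
  topSpace κ ν c₁ c₂ B Δ V ⊓ weightSpace κ ν c₁ c₂ B H V (Λ + cartanWeight 0 n H)

lemma op_mem_topWeightSpace {X : FullToroidal κ ν c₁ c₂} (hX : IsWeightVector H 0 m X)
    (hT : ∀ x ∈ posPart Δ, ∀ f : Laurent ν, ∃ x' ∈ posPart Δ, ∃ f' : Laurent ν,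
      ⁅(ofLoop (f ⊗ₜ[ℂ] x) : FullToroidal κ ν c₁ c₂), X⁆ = ofLoop (f' ⊗ₜ[ℂ] x')) (b : B) {v : V}
    (hv : v ∈ topWeightSpace Δ B V Λ n) : op V b X v ∈ topWeightSpace Δ B V Λ (n + m) := by
  refine ⟨fun x hx f b' => ?_, ?_⟩
  · obtain ⟨x', hx', f', h⟩ := hT x hx f
    rw [op_apply, leibniz_lie, map_lie_tmul, h, hv.1 x hx f b', lie_zero, add_zero]
    exact hv.1 x' hx' f' _
  · rw [cartanWeight_add, ← add_assoc]
    exact lie_mem_weightSpace hX b hv.2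

lemma op_tk_mem (p : Fin (ν + 1)) (b : B) {v : V} (hv : v ∈ topWeightSpace Δ B V Λ n) :
    op V b (tk m p : FullToroidal κ ν c₁ c₂) v ∈ topWeightSpace Δ B V Λ (n + m) :=
  op_mem_topWeightSpace (isWeightVector_tk H p)
    (fun x hx f => ⟨x, hx, 0, by rw [lie_ofLoop_tk, TensorProduct.zero_tmul, map_zero]⟩) b hv

lemma op_td_mem (a : Fin (ν + 1)) (b : B) {v : V} (hv : v ∈ topWeightSpace Δ B V Λ n) :
    op V b (td m a : FullToroidal κ ν c₁ c₂) v ∈ topWeightSpace Δ B V Λ (n + m) :=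
  op_mem_topWeightSpace (isWeightVector_td H a)
    (fun x hx f => ⟨x, hx, _, lie_ofLoop_td f x a⟩) b hv

/-- `H ⊗ A` normalises `𝔤₊ ⊗ A`, with no `𝒦`-term because `H` is orthogonal to `𝔤₊`. -/
lemma op_xt_mem {h : 𝔤} (hh : h ∈ H) (b : B) {v : V} (hv : v ∈ topWeightSpace Δ B V Λ n) :
    op V b (xt h m : FullToroidal κ ν c₁ c₂) v ∈ topWeightSpace Δ B V Λ (n + m) :=
  op_mem_topWeightSpace
    (isWeightVector_xt fun h' hh' => by rw [lie_eq_zero_of_mem_cartan hh' hh]; simp)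
    (fun x hx f => ⟨_, lie_mem_posPart hx hh, _,
      lie_ofLoop_xt f (form_posPart_eq_zero κ hx hh)⟩) b hv

/-- The weight spaces of `T` with a fixed nonzero `𝔥̇`-weight have uniformly bounded dimension. -/
lemma exists_finrank_topWeightSpace_le (hfin : InCfin κ ν c₁ c₂ B H V)
    (hzero : ZeroCentralCharge κ ν c₁ c₂ B V) (hΛ : Λ ∘ₗ finCartan κ ν c₁ c₂ H ≠ 0) :
    ∃ D : ℕ, ∀ n, FiniteDimensional ℂ (topWeightSpace Δ B V Λ n) ∧
      Module.finrank ℂ (topWeightSpace Δ B V Λ n) ≤ D := by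
  obtain ⟨α, hα, hΛα⟩ := exists_isPos_coroot_ne_zero Δ hΛ
  obtain ⟨h, e, f, ht, he, hf⟩ := exists_isSl2Triple_of_weight_isNonZero (Finset.mem_filter.mp α.2).2
  have hh := ht.h_eq_coroot (Finset.mem_filter.mp α.2).2 he hf
  -- `φ` is `-α`, extended arbitrarily to `𝔤` because `weightForm` takes a functional there; only
  -- its values on `H` matter.
  obtain ⟨φ, hφ⟩ := LinearMap.exists_extend
    (-(LieModule.Weight.toLinear ℂ H 𝔤 α.1) : H.toSubmodule →ₗ[ℂ] ℂ)
  have hfw : ∀ h' ∈ H, ⁅h', f⁆ = φ h' • f := by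
    intro h' hh'
    have h1 : ⁅h', f⁆ = (-α.1 : H → ℂ) ⟨h', hh'⟩ • f := lie_eq_smul_of_mem_rootSpace hf ⟨h', hh'⟩
    have h2 : φ h' = -(α.1 ⟨h', hh'⟩) := LinearMap.congr_fun hφ ⟨h', hh'⟩
    rw [h1, h2]; rfl
  have hfd := hfin.finiteDimensional (Λ + cartanWeight φ 0 H)
  refine ⟨Module.finrank ℂ (weightSpace κ ν c₁ c₂ B H V (Λ + cartanWeight φ 0 H)), fun n => ?_⟩
  have hmaps : ∀ v ∈ topWeightSpace Δ B V Λ n, op V (1 : B) (xt f (-n) : FullToroidal κ ν c₁ c₂) v ∈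
      weightSpace κ ν c₁ c₂ B H V (Λ + cartanWeight φ 0 H) := by
    intro v hv
    rw [← cartanWeight_add_neg (n := n), ← add_assoc]
    exact lie_mem_weightSpace (isWeightVector_xt hfw) 1 hv.2
  let F := (op V (1 : B) (xt f (-n) : FullToroidal κ ν c₁ c₂)).restrict hmaps
  have hF : Function.Injective F := by
    rw [injective_iff_map_eq_zero]
    rintro ⟨v, hv⟩ hv0
    have hv0 : op V (1 : B) (xt f (-n) : FullToroidal κ ν c₁ c₂) v = 0 := congrArg Subtype.val hv0
    have hev : op V (1 : B) (xt e n : FullToroidal κ ν c₁ c₂) v = 0 :=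
      hv.1 e (rootSpace_le_posPart hα he) _ 1
    -- If `f ⊗ t^{-n}` kills `v`, so does `[e ⊗ t^n, f ⊗ t^{-n}]`, which acts by `Λ(α^∨)`: its
    -- central term has charge zero.
    have h1 := LinearMap.congr_fun (op_commutator (V := V) (1 : B) 1
      (xt e n : FullToroidal κ ν c₁ c₂) (xt f (-n) : FullToroidal κ ν c₁ c₂)) v
    rw [LinearMap.sub_apply, Module.End.mul_apply, Module.End.mul_apply, hv0, hev, map_zero,
      map_zero, sub_zero, lie_xt_xt, ht.lie_e_f, add_neg_cancel, one_mul, map_add, map_smul,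
      op_sum_tk_zero hzero, smul_zero, add_zero, hh] at h1
    have h2 := hv.2 (finCartan κ ν c₁ c₂ H (coroot α.1))
    have h3 : cartanWeight 0 n H (finCartan κ ν c₁ c₂ H (coroot α.1)) = 0 :=
      weightForm_xt 0 n (coroot α.1 : 𝔤)
    rw [LinearMap.add_apply, h3, add_zero] at h2
    have h4 : Λ (finCartan κ ν c₁ c₂ H (coroot α.1)) • v = 0 := h2.symm.trans h1.symm
    exact Subtype.ext ((smul_eq_zero.mp h4).resolve_left hΛα)
  exact ⟨FiniteDimensional.of_injective F hF, LinearMap.finrank_le_finrank_of_injective hF⟩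

/-- Products of two distinct `t^s k_q`, `t^s' k_q` whose exponents differ by a multiple of `e_q`
are nilpotent on `T`. -/
lemma op_tk_mul_op_tk_pow_eq_zero {D : ℕ}
    (hD : ∀ n, FiniteDimensional ℂ (topWeightSpace Δ B V Λ n) ∧
      Module.finrank ℂ (topWeightSpace Δ B V Λ n) ≤ D)
    {h h' : 𝔤} (hh : h ∈ H) (hh' : h' ∈ H) (hκ : κ.form h h' ≠ 0) (s : Fin (ν + 1) → ℤ)
    (q : Fin (ν + 1)) {j : ℤ} (hj : j ≠ 0) {v : V} (hv : v ∈ topWeightSpace Δ B V Λ n) :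
    ((op V (1 : B) (tk s q : FullToroidal κ ν c₁ c₂) *
      op V (1 : B) (tk (s + Pi.single q j) q : FullToroidal κ ν c₁ c₂)) ^ (6 * D)) v = 0 := by
  -- `h` and `h'` commute, so only the central term remains; the first exponent `j e_q` selects the
  -- single symbol `k_q`.
  have hrel : op V (1 : B) (xt h (Pi.single q j) : FullToroidal κ ν c₁ c₂) *
        op V (1 : B) (xt h' (s - Pi.single q j) : FullToroidal κ ν c₁ c₂) -
      op V (1 : B) (xt h' (s - Pi.single q j) : FullToroidal κ ν c₁ c₂) *
        op V (1 : B) (xt h (Pi.single q j) : FullToroidal κ ν c₁ c₂) =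
      (κ.form h h' * j) • op V (1 : B) (tk s q : FullToroidal κ ν c₁ c₂) := by
    have hsum : ∑ p, ((Pi.single q j : Fin (ν + 1) → ℤ) p : ℂ) •
        (tk s p : FullToroidal κ ν c₁ c₂) = (j : ℂ) • tk s q := by
      rw [Finset.sum_eq_single q]
      · simp
      · intro r _ hr; simp [hr]
      · simp
    rw [op_commutator, lie_xt_xt, lie_eq_zero_of_mem_cartan hh hh', add_sub_cancel, hsum, smul_smul,
      one_mul]
    simp [xt]
  have hc : (κ.form h h' * j : ℂ) ≠ 0 := mul_ne_zero hκ (Int.cast_ne_zero.mpr hj)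
  have hkx : ∀ (x : 𝔤) (r r' : Fin (ν + 1) → ℤ), Commute
      (op V (1 : B) (tk r q : FullToroidal κ ν c₁ c₂))
      (op V (1 : B) (xt x r' : FullToroidal κ ν c₁ c₂)) := fun x r r' =>
    op_commute (lie_tk_xt _ _) _ _
  have hkk : ∀ r r' : Fin (ν + 1) → ℤ, Commute
      (op V (1 : B) (tk r q : FullToroidal κ ν c₁ c₂))
      (op V (1 : B) (tk r' q : FullToroidal κ ν c₁ c₂)) := fun r r' => op_tk_commute _ _ _ _ _ _
  have hcongr : ∀ {r r' : Fin (ν + 1) → ℤ} {u : V}, r = r' → u ∈ topWeightSpace Δ B V Λ r →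
      u ∈ topWeightSpace Δ B V Λ r' := fun h hu => h ▸ hu
  have hfd : ∀ k : ℕ, FiniteDimensional ℂ
      (topWeightSpace Δ B V Λ (n + k • (s + (s + Pi.single q j)))) := fun k => (hD _).1
  -- The grading is by multiples of `2s + j e_q`, the degree of `z z'`. The padded operators have
  -- degrees `j e_q + 2s` and `(s - j e_q) + 3(s + j e_q)`, that is, one and two steps.
  refine pow_apply_eq_zero_of_commutator
    (fun k : ℕ => topWeightSpace Δ B V Λ (n + k • (s + (s + Pi.single q j)))) D
    (fun k => (hD _).2) ?_ ?_ ?_ ?_ ?_ hc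
    (mul_commutator_eq_pow hrel (hkx _ _ _) (hkx _ _ _) (hkk _ _)) v
    (hcongr (by simp) hv)
  · intro k u hu
    refine hcongr ?_ (op_tk_mem q 1 (op_tk_mem q 1 hu))
    module
  · intro k u hu
    refine hcongr ?_ (op_xt_mem hh 1 (op_tk_mem q 1 (op_tk_mem q 1 hu)))
    module
  · intro k u hu
    refine hcongr ?_ (op_xt_mem hh' 1 (op_tk_mem q 1 (op_tk_mem q 1 (op_tk_mem q 1 hu))))
    module
  · exact ((hkx _ _ _).mul_left (hkx _ _ _)).mul_right
      (((hkk _ _).mul_left (hkk _ _)).pow_right 2)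
  · exact ((hkx _ _ _).mul_left (hkx _ _ _)).mul_right
      (((hkk _ _).mul_left (hkk _ _)).pow_right 3)

variable (Δ B V Λ) in
/-- The sum of the weight spaces of `T` whose weight agrees with `Λ` on `𝔥̇` up to `ℤ`-shifts of
the degrees. -/
def topComponent : Submodule ℂ V := ⨆ n, topWeightSpace Δ B V Λ n

lemma map_mem_topComponent {F : Module.End ℂ V} (m : Fin (ν + 1) → ℤ)
    (hF : ∀ n, ∀ v ∈ topWeightSpace Δ B V Λ n, F v ∈ topWeightSpace Δ B V Λ (n + m)) :
    ∀ v ∈ topComponent Δ B V Λ, F v ∈ topComponent Δ B V Λ := by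
  have : topComponent Δ B V Λ ≤ (topComponent Δ B V Λ).comap F :=
    iSup_le fun n v hv => Submodule.mem_iSup_of_mem (n + m) (hF n v hv)
  exact this

/-- `t_a k_q` is nilpotent on the top component, for `a ≠ q`. -/
lemma exists_op_tk_pow_eq_zero {D : ℕ}
    (hD : ∀ n, FiniteDimensional ℂ (topWeightSpace Δ B V Λ n) ∧
      Module.finrank ℂ (topWeightSpace Δ B V Λ n) ≤ D)
    {h h' : 𝔤} (hh : h ∈ H) (hh' : h' ∈ H) (hκ : κ.form h h' ≠ 0) {a q : Fin (ν + 1)}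
    (haq : a ≠ q) : ∃ E : ℕ, ∀ v ∈ topComponent Δ B V Λ,
      (op V (1 : B) (tk (Pi.single a 1) q : FullToroidal κ ν c₁ c₂) ^ E) v = 0 := by
  have hk : ∀ r, ∀ v ∈ topComponent Δ B V Λ,
      op V (1 : B) (tk r q : FullToroidal κ ν c₁ c₂) v ∈ topComponent Δ B V Λ := fun r =>
    map_mem_topComponent r fun n v hv => op_tk_mem q 1 hv
  have hd : ∀ v ∈ topComponent Δ B V Λ,
      op V (1 : B) (td (-Pi.single q 1) a : FullToroidal κ ν c₁ c₂) v ∈ topComponent Δ B V Λ :=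
    map_mem_topComponent _ fun n v hv => op_td_mem a 1 hv
  -- Restriction to the top component turns vanishing of a uniform power there into nilpotency in a
  -- ring, as the ladder argument requires.
  let Z : ℤ → Module.End ℂ (topComponent Δ B V Λ) := fun j =>
    (op V (1 : B) (tk (Pi.single a 1 + Pi.single q j) q : FullToroidal κ ν c₁ c₂)).restrict (hk _)
  have hZ0 : IsNilpotent (Z 0) := by
    refine isNilpotent_of_ladder
      (d := (op V (1 : B) (td (-Pi.single q 1) a : FullToroidal κ ν c₁ c₂)).restrict hd) ?_ ?_ ?_
    · intro i j
      ext v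
      exact LinearMap.congr_fun (op_tk_commute (V := V) (κ := κ) (c₁ := c₁) (c₂ := c₂) _ _ q q
        (1 : B) 1).eq (v : V)
    · intro j
      ext v
      have h1 := LinearMap.congr_fun (op_commutator (V := V) (1 : B) 1
        (td (-Pi.single q 1) a : FullToroidal κ ν c₁ c₂)
        (tk (Pi.single a 1 + Pi.single q j) q : FullToroidal κ ν c₁ c₂)) (v : V)
      have h2 : (-Pi.single q 1 + (Pi.single a 1 + Pi.single q j) : Fin (ν + 1) → ℤ) =
          Pi.single a 1 + Pi.single q (j - 1) := by
        rw [Pi.single_sub]; abel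
      -- The coefficient is the exponent of `t_a`, equal to `1`, so the shift by `t_q^{-1} d_a` is
      -- exact; `a ≠ q` removes the `δ`-term.
      rw [lie_td_tk, if_neg haq, add_zero, h2, Pi.add_apply, Pi.single_eq_same,
        Pi.single_eq_of_ne haq, add_zero, Int.cast_one, one_smul, mul_one] at h1
      exact h1
    · intro i j hij
      refine ⟨6 * D, ?_⟩
      have h1 : ∀ v ∈ topComponent Δ B V Λ,
          ((op V (1 : B) (tk (Pi.single a 1 + Pi.single q i) q : FullToroidal κ ν c₁ c₂) *
            op V (1 : B) (tk (Pi.single a 1 + Pi.single q j) q : FullToroidal κ ν c₁ c₂)) ^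
              (6 * D)) v = 0 := by
        have hle : topComponent Δ B V Λ ≤ LinearMap.ker
            ((op V (1 : B) (tk (Pi.single a 1 + Pi.single q i) q : FullToroidal κ ν c₁ c₂) *
            op V (1 : B) (tk (Pi.single a 1 + Pi.single q j) q : FullToroidal κ ν c₁ c₂)) ^
              (6 * D)) := by
          refine iSup_le fun n v hv => ?_
          -- Here `s = e_a + i e_q`, and the exponents differ by `(j - i) e_q`.
          have h2 := op_tk_mul_op_tk_pow_eq_zero hD hh hh' hκ (Pi.single a 1 + Pi.single q i) q
            (sub_ne_zero.mpr hij.symm) hv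
          rwa [add_assoc, ← Pi.single_add, add_sub_cancel] at h2
        exact hle
      have h3 : Z i * Z j =
          (op V (1 : B) (tk (Pi.single a 1 + Pi.single q i) q : FullToroidal κ ν c₁ c₂) *
            op V (1 : B) (tk (Pi.single a 1 + Pi.single q j) q : FullToroidal κ ν c₁ c₂)).restrict
            (fun v hv => hk _ _ (hk _ _ hv)) := rfl
      rw [h3, Module.End.pow_restrict]
      ext v
      exact h1 v v.2
  obtain ⟨E, hE⟩ := hZ0
  refine ⟨E, fun v hv => ?_⟩
  have h4 := Module.End.pow_restrict E (hk (Pi.single a 1 + Pi.single q 0))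
  change Z 0 ^ E = _ at h4
  rw [hE] at h4
  have h5 := congrArg Subtype.val (LinearMap.congr_fun h4 ⟨v, hv⟩)
  rw [LinearMap.coe_restrict_apply, Pi.single_zero, add_zero] at h5
  exact h5.symm

end graded

end MapToroidal
end

/-! ### Conclusion -/

open MapToroidal MapToroidal.FullToroidal in
theorem theorem5p5
    {𝔤 : Type*} [LieRing 𝔤] [LieAlgebra ℂ 𝔤] [FiniteDimensional ℂ 𝔤] [LieAlgebra.IsSimple ℂ 𝔤]
    (H : LieSubalgebra ℂ 𝔤) [H.IsCartanSubalgebra]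
    (Δ : (LieAlgebra.IsKilling.rootSystem H).Base)
    (κ : InvariantForm 𝔤) (ν : ℕ) (hν : 1 ≤ ν) (c₁ c₂ : ℂ)
    {B : Type*} [CommRing B] [Algebra ℂ B] [Algebra.FiniteType ℂ B]
    {V : Type*} [AddCommGroup V] [Module ℂ V] [LieRingModule (MapFullToroidal κ ν c₁ c₂ B) V]
    [LieModule ℂ (MapFullToroidal κ ν c₁ c₂ B) V]
    (hirr : LieModule.IsIrreducible ℂ (MapFullToroidal κ ν c₁ c₂ B) V)
    (hfin : InCfin κ ν c₁ c₂ B H V)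
    (hzero : ZeroCentralCharge κ ν c₁ c₂ B V)
    (Λ : Module.Dual ℂ (cartan κ ν c₁ c₂ H))
    (hΛT : topSpace κ ν c₁ c₂ B Δ V ⊓ weightSpace κ ν c₁ c₂ B H V Λ ≠ ⊥)
    (hΛ : Λ ∘ₗ finCartan κ ν c₁ c₂ H ≠ 0) :
    ∀ (m : Fin (ν + 1) → ℤ) (p : Fin (ν + 1)) (b : B), ∀ v ∈ topSpace κ ν c₁ c₂ B Δ V,
      ⁅(b ⊗ₜ[ℂ] tk m p : MapFullToroidal κ ν c₁ c₂ B), v⁆ = 0 := by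
  obtain ⟨D, hD⟩ := exists_finrank_topWeightSpace_le (Δ := Δ) hfin hzero hΛ
  -- A nonzero `h` pairs nontrivially with some `h'` in the Cartan subalgebra, which provides the
  -- Heisenberg pair.
  obtain ⟨h, hh⟩ : ∃ h : H, h ≠ 0 := by
    by_contra! h0
    exact hΛ (LinearMap.ext fun h => by rw [h0 h, map_zero, map_zero])
  obtain ⟨h', hh', hκ⟩ := exists_form_ne_zero κ h.2 (fun h0 => hh (Subtype.ext h0))
  have hM : topComponent Δ B V Λ ≠ ⊥ := by
    obtain ⟨v, hv, hv0⟩ := Submodule.exists_mem_ne_zero_of_ne_bot hΛT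
    have hv' : v ∈ topWeightSpace Δ B V Λ 0 := by
      rw [topWeightSpace, cartanWeight_zero, add_zero]; exact hv
    intro h0
    have hv'' : v ∈ topComponent Δ B V Λ := Submodule.mem_iSup_of_mem 0 hv'
    rw [h0] at hv''
    exact hv0 ((Submodule.mem_bot ℂ).mp hv'')
  obtain ⟨w, hw0, hw⟩ := exists_killed hν hM
    (fun b m p => map_mem_topComponent m fun n v hv => op_tk_mem p b hv)
    (fun b m p => map_mem_topComponent m fun n v hv => op_td_mem p b hv)
    (fun a q haq => exists_op_tk_pow_eq_zero hD h.2 hh' hκ haq)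
  intro m p b v _
  exact op_tk_eq_zero_of_irreducible hirr hw0 hw b m p v
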